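/- Let $A\in\mathbb{R}^{n\times n}$, $B\in\mathbb{R}^{n\times m}$, $C\in\mathbb{R}^{m\times n}$, $D\in\mathbb{R}^{m\times m}$, and let the state-space system $\dot x=Ax+Bu$, $y=Cx+Du$ be minimal, i.e. no state-space system with fewer states has the same transfer function matrix $M(s)=C(sI-A)^{-1}B+D$. The system is called strictly negative-imaginary (SNI) if all poles of $M(s)$ lie in the open left half plane and, for all $\omega>0$, the Hermitian matrix $\jmath\,[M(\jmath\omega)-M^{*}(\jmath\omega)]$ is positive definite. A point $z\in\mathbb{C}$ is called a transmission zero of a square rational matrix $G(s)$ if there is a polynomial vector $u(s)$ with $u(z)\neq 0$ such that $G(s)u(s)$ is regular at $z$ and vanishes there; if $z$ is not a pole of $G$, this means $\det G(z)=0$. (In particular, if $\det G\equiv 0$, then every point is a transmission zero of $G$.) The system is SNI if and only if the following four conditions hold: 1. $A$ has no eigenvalues on the imaginary axis. 2. $D$ is symmetric. 3. There exists a (symmetric) positive-definite matrix $Y\in\mathbb{R}^{n\times n}$ such that $AY+YA^{\rm T}\le 0$ and $B+AYC^{\rm T}=0$. 4. $M(s)-M^{\rm T}(-s)$ has no transmission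 zeros on the imaginary axis except possibly at $s=0$. -/

import Mathlib

open scoped ComplexOrder

noncomputable section

namespace NegImag

/-- The transfer function matrix `M(s) = C (s I - A)⁻¹ B + D` of the real state-space system
`x' = A x + B u`, `y = C x + D u`, as a matrix of rational functions of `s`. The inverse is the
genuine one, because `s I - A` is invertible over the field of rational functions. -/
def transferMatrix {n m : ℕ} (A : Matrix (Fin n) (Fin n) ℝ) (B : Matrix (Fin n) (Fin m) ℝ)
    (C : Matrix (Fin m) (Fin n) ℝ) (D : Matrix (Fin m) (Fin m) ℝ) :
    Matrix (Fin m) (Fin m) (RatFunc ℂ) :=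
  let ι : ℝ → RatFunc ℂ := fun r => RatFunc.C (r : ℂ)
  C.map ι * (Matrix.scalar (Fin n) RatFunc.X - A.map ι)⁻¹ * B.map ι + D.map ι

/-- A state-space system is minimal if no state-space system with fewer states has the same
transfer function matrix. -/
def IsMinimal {n m : ℕ} (A : Matrix (Fin n) (Fin n) ℝ) (B : Matrix (Fin n) (Fin m) ℝ)
    (C : Matrix (Fin m) (Fin n) ℝ) (D : Matrix (Fin m) (Fin m) ℝ) : Prop :=
  ∀ (k : ℕ) (A' : Matrix (Fin k) (Fin k) ℝ) (B' : Matrix (Fin k) (Fin m) ℝ)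
    (C' : Matrix (Fin m) (Fin k) ℝ) (D' : Matrix (Fin m) (Fin m) ℝ),
    transferMatrix A' B' C' D' = transferMatrix A B C D → n ≤ k

/-- `z` is a pole of the rational matrix `P` if it is a pole of some entry, i.e. a root of the
denominator of that entry in lowest terms. -/
def IsPole {m : ℕ} (P : Matrix (Fin m) (Fin m) (RatFunc ℂ)) (z : ℂ) : Prop :=
  ∃ i j, (P i j).denom.IsRoot z

/-- The value `P(z)`, meaningful when `z` is not a pole of `P`. -/
def evalAt {m : ℕ} (P : Matrix (Fin m) (Fin m) (RatFunc ℂ)) (z : ℂ) :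
    Matrix (Fin m) (Fin m) ℂ :=
  P.map (RatFunc.eval (RingHom.id ℂ) z)

/-- `P` is strictly negative-imaginary: all poles lie in the open left half plane, and
`j (P(jω) - P(jω)*) > 0` for all `ω > 0`. -/
structure IsSNI {m : ℕ} (P : Matrix (Fin m) (Fin m) (RatFunc ℂ)) : Prop where
  poles : ∀ z : ℂ, IsPole P z → z.re < 0
  posDef : ∀ ω : ℝ, 0 < ω →
    (Complex.I • (evalAt P (ω * Complex.I) - (evalAt P (ω * Complex.I)).conjTranspose)).PosDef

/-- The rational matrix `P(-s)ᵀ`, obtained by substituting `-s` for `s` and transposing. -/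
def reflectTranspose {m : ℕ} (P : Matrix (Fin m) (Fin m) (RatFunc ℂ)) :
    Matrix (Fin m) (Fin m) (RatFunc ℂ) :=
  (P.map (RatFunc.eval RatFunc.C (-RatFunc.X))).transpose

/-- `z` is a transmission zero of the square rational matrix `G` if there is a polynomial vector
`u` with `u(z) ≠ 0` for which `G(s) u(s)` is regular at `z` and vanishes there (its entries in
lowest terms have numerators vanishing at `z`).

If `z` is not a pole of `G`, this says that `G(z) v = 0` for some `v ≠ 0`. If `det G` is not
identically zero, these are the zeros of the Smith-McMillan form of `G`, including those that are
also poles. If `det G` is identically zero, then `G` has a transmission zero everywhere. -/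
def IsTransmissionZero {m : ℕ} (G : Matrix (Fin m) (Fin m) (RatFunc ℂ)) (z : ℂ) : Prop :=
  ∃ u : Fin m → Polynomial ℂ, (∃ j, (u j).eval z ≠ 0) ∧
    ∀ i, (G.mulVec (fun j => algebraMap (Polynomial ℂ) (RatFunc ℂ) (u j)) i).num.IsRoot z

end NegImag

end

/-! ### Skew-Hermitian products and rank-one decompositions -/

namespace NegImag

open Matrix Complex

/-! Sufficiency is a computation. Write `R = (jωI - A)⁻¹`. The relation `B = -AYCᵀ` and the symmetry
of `D` give `j[M(jω) - M(jω)*] = ω (CR) (-(AY + YAᵀ)) (CR)*` (`imaginary_part_factorization`), which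
is positive semidefinite for `ω > 0`. On the axis `M(-s)ᵀ` takes the value `M(s)*`, so a kernel
vector would be a transmission zero; condition 4 upgrades the form to positive definite. The
Lyapunov inequality together with condition 1 makes `A` Hurwitz (`isHurwitz_of_lyapunov`).

For necessity, minimality makes every eigenvalue of `A` a pole (`IsMinimal.isPole_of_eigenvalue`),
so `A` is Hurwitz. Letting `ω → ∞` shows that `D` is symmetric. Then `s C (sI - A)⁻¹ B` has
nonnegative Hermitian part on the whole axis, and the Kalman-Yakubovich-Popov lemma gives a
symmetric `P` with `(Px - Cᵀu) ⬝ (Ax + Bu) ≤ 0` (`exists_storage`). Stability and observability make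
`P` positive definite, and `Y = P⁻¹` works (`exists_posDef_of_freq`).

The KYP lemma is proved by duality. If the strict inequality had no solution, a separating
hyperplane would give a nonzero semidefinite `S = VVᵀ` with `KSEᵀ` skew. Such an `S` splits into
rank-one terms on which the frequency condition applies (`re_trace_neg_of_skew`), a contradiction.
The nonstrict case follows by compactness, controllability excluding escape to infinity. -/

theorem exists_pseudoinverse {n N : Type*} [Fintype n] [Fintype N] [DecidableEq N]
    (X : Matrix n N ℂ) : ∃ G : Matrix N n ℂ, X * G * X = X ∧ (G * X)ᴴ = G * X := by
  have hH : (Xᴴ * X).IsHermitian := isHermitian_conjTranspose_mul_self X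
  set U : Matrix N N ℂ := hH.eigenvectorUnitary.1
  have hU1 : Uᴴ * U = 1 := (Matrix.mem_unitaryGroup_iff').1 hH.eigenvectorUnitary.2
  have hU2 : U * Uᴴ = 1 := (Matrix.mem_unitaryGroup_iff).1 hH.eigenvectorUnitary.2
  set d : N → ℂ := fun i => (hH.eigenvalues i : ℂ)
  have hspec : Xᴴ * X = U * diagonal d * Uᴴ := hH.spectral_theorem
  have hGX : U * diagonal (fun i => (d i)⁻¹) * Uᴴ * Xᴴ * X
      = U * diagonal (fun i => (d i)⁻¹ * d i) * Uᴴ := by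
    rw [Matrix.mul_assoc _ Xᴴ X, hspec, ← diagonal_mul_diagonal]
    calc _ = U * diagonal (fun i => (d i)⁻¹) * (Uᴴ * U) * diagonal d * Uᴴ := by
          simp only [Matrix.mul_assoc]
      _ = _ := by rw [hU1]; simp only [Matrix.mul_assoc, Matrix.one_mul]
  have hreal : ∀ i, star (d i) = d i := fun i => Complex.conj_ofReal _
  have hP : (U * diagonal (fun i => (d i)⁻¹ * d i) * Uᴴ)ᴴ
      = U * diagonal (fun i => (d i)⁻¹ * d i) * Uᴴ := by
    simp only [conjTranspose_mul, conjTranspose_conjTranspose, diagonal_conjTranspose,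
      Matrix.mul_assoc]
    congr 3
    ext i
    simp [hreal i]
  -- Since `0⁻¹ = 0`, each `(d i)⁻¹ * d i` is 0 or 1, and `G * X` is the orthogonal projection with
  -- the same kernel as `X`.
  refine ⟨U * diagonal (fun i => (d i)⁻¹) * Uᴴ * Xᴴ, ?_, by rw [hGX, hP]⟩
  rw [Matrix.mul_assoc, hGX, ← sub_eq_zero, ← conjTranspose_mul_self_eq_zero]
  set P := U * diagonal (fun i => (d i)⁻¹ * d i) * Uᴴ with hPdef
  have hXXP : Xᴴ * X * P = Xᴴ * X := by
    rw [hspec]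
    calc _ = U * diagonal d * (Uᴴ * U) * diagonal (fun i => (d i)⁻¹ * d i) * Uᴴ := by
          simp only [hPdef, Matrix.mul_assoc]
      _ = U * (diagonal d * diagonal (fun i => (d i)⁻¹ * d i)) * Uᴴ := by
          rw [hU1]; simp only [Matrix.mul_assoc, Matrix.one_mul]
      _ = _ := by
          rw [diagonal_mul_diagonal]
          congr 3
          ext i
          by_cases h : d i = 0
          · simp [h]
          · field_simp
  have hPXX : P * (Xᴴ * X) = Xᴴ * X := by
    have := congrArg conjTranspose hXXP
    rwa [conjTranspose_mul, hP, hH.eq] at this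
  rw [conjTranspose_sub, conjTranspose_mul, hP, Matrix.sub_mul, Matrix.mul_sub, Matrix.mul_sub]
  simp only [← Matrix.mul_assoc] at hPXX hXXP ⊢
  rw [hPXX, hXXP]
  simp

theorem trace_conj_eq_sum {N k : Type*} [Fintype N] [Fintype k]
    (V : Matrix N k ℂ) (H : Matrix N N ℂ) :
    (Vᴴ * H * V).trace = ∑ i, star (V.col i) ⬝ᵥ H *ᵥ (V.col i) := by
  simp only [trace, diag_apply]
  refine Finset.sum_congr rfl fun i _ => ?_
  rw [Matrix.mul_assoc, Matrix.mul_apply_eq_vecMul, ← Matrix.mul_apply_eq_vecMul,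
    Matrix.mul_apply]
  rfl

theorem re_trace_conj_nonpos {N k : Type*} [Fintype N] [Fintype k]
    (V : Matrix N k ℂ) (H : Matrix N N ℂ)
    (h : ∀ i, V.col i ≠ 0 → (star (V.col i) ⬝ᵥ H *ᵥ (V.col i)).re < 0) :
    (Vᴴ * H * V).trace.re ≤ 0 ∧ (V ≠ 0 → (Vᴴ * H * V).trace.re < 0) := by
  have h' : ∀ i, (star (V.col i) ⬝ᵥ H *ᵥ (V.col i)).re ≤ 0 := fun i => by
    by_cases hi : V.col i = 0
    · simp [hi]
    · exact (h i hi).le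
  rw [trace_conj_eq_sum, Complex.re_sum]
  refine ⟨Finset.sum_nonpos fun i _ => h' i, fun hV => ?_⟩
  obtain ⟨i, hi⟩ : ∃ i, V.col i ≠ 0 := by
    by_contra! hc
    exact hV (by ext a b; exact congrFun (hc b) a)
  exact Finset.sum_neg' (fun i _ => h' i) ⟨i, Finset.mem_univ i, h i hi⟩

/-- If `K W Wᴴ Eᴴ` is skew-Hermitian, then `W Wᴴ` is a sum of rank-one terms `w wᴴ` with
`E w = 0` or `K w = j ω E w`; hence the trace of a form that is negative on those vectors is
negative. -/
theorem re_trace_neg_of_skew {n N k : Type*} [Fintype n] [Fintype N] [Fintype k] [DecidableEq k]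
    (E K : Matrix n N ℂ) (H : Matrix N N ℂ) (W : Matrix N k ℂ)
    (hskew : K * W * (E * W)ᴴ + E * W * (K * W)ᴴ = 0)
    (hH : ∀ w : N → ℂ, w ≠ 0 → (E *ᵥ w = 0 ∨ ∃ ω : ℝ, K *ᵥ w = (I * ω) • E *ᵥ w) →
      (star w ⬝ᵥ H *ᵥ w).re < 0) :
    (Wᴴ * H * W).trace.re ≤ 0 ∧ (W ≠ 0 → (Wᴴ * H * W).trace.re < 0) := by
  obtain ⟨G, hG1, hG2⟩ := exists_pseudoinverse (E * W)
  set X := E * W with hX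
  set Y := K * W with hY
  set P := G * X with hP
  have hXP : X * P = X := by rw [hP, ← Matrix.mul_assoc, hG1]
  have hPP : P * P = P := by
    rw [hP, Matrix.mul_assoc, ← Matrix.mul_assoc X, hG1]
  have hYX : Y * Xᴴ = -(X * Yᴴ) := eq_neg_of_add_eq_zero_left hskew
  have hPG : P = Xᴴ * Gᴴ := by rw [← hG2, hP, conjTranspose_mul]
  -- `T` is the skew-Hermitian solution of `X * T = Y * P`. With `U` an eigenbasis of `I • T`, the
  -- columns of `W * P * U` satisfy `K w = jω E w`, those of `W * (1 - P)` satisfy `E w = 0`, and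
  -- the two families together rebuild `W * Wᴴ`.
  set T := G * Y * P with hT
  have hXT : X * T = Y * P := by
    have h1 : Y * P = -(X * Yᴴ * Gᴴ) := by
      rw [hPG, ← Matrix.mul_assoc, hYX, Matrix.neg_mul]
    rw [hT, Matrix.mul_assoc G, h1]
    simp only [Matrix.mul_neg, ← Matrix.mul_assoc]
    rw [hG1]
  have hTs : Tᴴ = -T := by
    have : T = G * (Y * Xᴴ) * Gᴴ := by rw [hT, hPG]; simp only [Matrix.mul_assoc]
    rw [this]
    rw [conjTranspose_mul, conjTranspose_mul, conjTranspose_mul, conjTranspose_conjTranspose,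
      conjTranspose_conjTranspose, hYX]
    simp only [Matrix.mul_neg, Matrix.neg_mul, neg_neg, Matrix.mul_assoc]
  have hTH : (I • T).IsHermitian := by
    rw [IsHermitian, conjTranspose_smul, hTs]
    simp
  set U : Matrix k k ℂ := hTH.eigenvectorUnitary.1
  have hU1 : Uᴴ * U = 1 := (Matrix.mem_unitaryGroup_iff').1 hTH.eigenvectorUnitary.2
  have hU2 : U * Uᴴ = 1 := (Matrix.mem_unitaryGroup_iff).1 hTH.eigenvectorUnitary.2
  have hspec : I • T = U * diagonal (fun i => (hTH.eigenvalues i : ℂ)) * Uᴴ :=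
    hTH.spectral_theorem
  have hTU : T * U = -I • (U * diagonal (fun i => (hTH.eigenvalues i : ℂ))) := by
    have h1 : T * U = -I • ((I • T) * U) := by rw [Matrix.smul_mul, smul_smul]; simp
    have h2 : (I • T) * U = U * diagonal (fun i => (hTH.eigenvalues i : ℂ)) :=
      (congrArg (· * U) hspec).trans (by rw [Matrix.mul_assoc, hU1, Matrix.mul_one])
    rw [h1, h2]
  have key1 := re_trace_conj_nonpos (W * (1 - P)) H (fun i hi => by
    refine hH _ hi (Or.inl ?_)
    have : E * (W * (1 - P)) = 0 := by
      rw [← Matrix.mul_assoc, ← hX, Matrix.mul_sub, hXP, Matrix.mul_one, sub_self]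
    ext a
    exact congrFun (congrFun this a) i)
  have key2 := re_trace_conj_nonpos (W * P * U) H (fun i hi => by
    refine hH _ hi (Or.inr ⟨-hTH.eigenvalues i, ?_⟩)
    have h1 : E * (W * P * U) = X * U := by
      rw [← Matrix.mul_assoc, ← Matrix.mul_assoc, ← hX, hXP]
    have h2 : K * (W * P * U) = -I • (X * U * diagonal (fun i => (hTH.eigenvalues i : ℂ))) := by
      rw [← Matrix.mul_assoc, ← Matrix.mul_assoc, ← hY, ← hXT, Matrix.mul_assoc X T, hTU,
        Matrix.mul_smul, ← Matrix.mul_assoc X U]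
    ext a
    have e1 : (E *ᵥ (W * P * U).col i) a = (X * U) a i := congrFun (congrFun h1 a) i
    have e2 : (K *ᵥ (W * P * U).col i) a
        = (-I • (X * U * diagonal (fun i => (hTH.eigenvalues i : ℂ)))) a i :=
      congrFun (congrFun h2 a) i
    rw [e2, Pi.smul_apply, e1]
    simp [mul_diagonal]
    ring)
  have htr1 : ((W * (1 - P))ᴴ * H * (W * (1 - P))).trace = (Wᴴ * H * W * (1 - P)).trace := by
    have : (1 - P) * (1 - P) = 1 - P := by
      rw [Matrix.mul_sub, Matrix.sub_mul, Matrix.sub_mul, hPP]; simp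
    rw [conjTranspose_mul, conjTranspose_sub, hG2, conjTranspose_one]
    rw [show (1 - P) * Wᴴ * H * (W * (1 - P)) = (1 - P) * (Wᴴ * H * W * (1 - P)) by
      simp only [Matrix.mul_assoc], trace_mul_comm, Matrix.mul_assoc, this]
  have htr2 : ((W * P * U)ᴴ * H * (W * P * U)).trace = (Wᴴ * H * W * P).trace := by
    rw [conjTranspose_mul, conjTranspose_mul, hG2]
    rw [show Uᴴ * (P * Wᴴ) * H * (W * P * U) = Uᴴ * (P * (Wᴴ * H * W * P) * U) by
      simp only [Matrix.mul_assoc], trace_mul_comm, Matrix.mul_assoc, hU2, Matrix.mul_one,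
      trace_mul_comm, Matrix.mul_assoc, hPP]
  have htr : (Wᴴ * H * W).trace.re
      = ((W * (1 - P))ᴴ * H * (W * (1 - P))).trace.re
        + ((W * P * U)ᴴ * H * (W * P * U)).trace.re := by
    rw [htr1, htr2, Matrix.mul_sub, trace_sub, Matrix.mul_one]
    simp
  refine ⟨by linarith [key1.1, key2.1], fun hW => ?_⟩
  by_cases hV : W * (1 - P) = 0
  · have : W * P * U ≠ 0 := by
      intro h0
      apply hW
      have h1 : W * P = 0 := by
        calc W * P = W * P * (U * Uᴴ) := by rw [hU2, Matrix.mul_one]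
          _ = W * P * U * Uᴴ := by simp only [Matrix.mul_assoc]
          _ = 0 := by rw [h0, Matrix.zero_mul]
      rw [Matrix.mul_sub, h1] at hV
      simpa using hV
    linarith [key1.1, key2.2 this]
  · linarith [key1.2 hV, key2.1]

end NegImag

/-! ### The strict KYP lemma by convex separation -/

namespace NegImag

open Matrix Complex

theorem map_ofReal_mul {a b c : Type*} [Fintype b] (M : Matrix a b ℝ) (M' : Matrix b c ℝ) :
    (M * M').map ofReal = M.map ofReal * M'.map ofReal :=
  Matrix.map_mul (f := Complex.ofRealHom)

theorem map_ofReal_add {a b : Type*} (M M' : Matrix a b ℝ) :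
    (M + M').map ofReal = M.map ofReal + M'.map ofReal := by
  ext i j; simp

theorem conjTranspose_map_ofReal {a b : Type*} (M : Matrix a b ℝ) :
    (M.map ofReal)ᴴ = Mᵀ.map ofReal := by
  ext i j; simp

theorem trace_map_ofReal {a : Type*} [Fintype a] (M : Matrix a a ℝ) :
    (M.map ofReal).trace = (M.trace : ℂ) := by
  simp [trace]

theorem exists_eq_mul_transpose {N : Type*} [Fintype N] {S : Matrix N N ℝ} (hS : S.PosSemidef) :
    ∃ (k : ℕ) (V : Matrix N (Fin k) ℝ), S = V * Vᵀ := by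
  obtain ⟨k, v, hv⟩ := Matrix.posSemidef_iff_eq_sum_vecMulVec.1 hS
  refine ⟨k, of fun i a => v a i, ?_⟩
  rw [hv]
  ext i j
  simp [Matrix.sum_apply, vecMulVec_apply, Matrix.mul_apply]

theorem posSemidef_map_ofReal {N : Type*} [Fintype N] {S : Matrix N N ℝ} (hS : S.PosSemidef) :
    (S.map ofReal).PosSemidef := by
  obtain ⟨k, V, rfl⟩ := exists_eq_mul_transpose hS
  rw [map_ofReal_mul, ← conjTranspose_map_ofReal]
  exact posSemidef_self_mul_conjTranspose _

/-- By homogeneity the sign need only be tested on the unit sphere, which is compact. -/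
theorem isOpen_negDef {N : Type*} [Fintype N] :
    IsOpen {X : Matrix N N ℝ | ∀ w : N → ℝ, w ≠ 0 → w ⬝ᵥ X *ᵥ w < 0} := by
  have hs : {X : Matrix N N ℝ | ∀ w : N → ℝ, w ≠ 0 → w ⬝ᵥ X *ᵥ w < 0}
      = {X | ∀ w ∈ Metric.sphere (0 : N → ℝ) 1, w ⬝ᵥ X *ᵥ w < 0} := by
    ext X
    refine ⟨fun h w hw => h w (by rintro rfl; simp at hw), fun h w hw => ?_⟩
    have hn : 0 < ‖w‖ := norm_pos_iff.2 hw
    have := h (‖w‖⁻¹ • w) (by simp [norm_smul, hn.ne'])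
    simp only [smul_dotProduct, mulVec_smul, dotProduct_smul, smul_eq_mul] at this
    by_contra! hc
    have : 0 ≤ ‖w‖⁻¹ * (‖w‖⁻¹ * (w ⬝ᵥ X *ᵥ w)) := by positivity
    linarith
  rw [hs, isOpen_iff_eventually]
  intro X hX
  refine (isCompact_sphere (0 : N → ℝ) 1).eventually_forall_of_forall_eventually fun w hw => ?_
  have hcont : Continuous fun p : Matrix N N ℝ × (N → ℝ) => p.2 ⬝ᵥ p.1 *ᵥ p.2 := by fun_prop
  exact hcont.continuousAt.eventually_lt continuousAt_const (hX w hw)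

theorem linear_functional_eq_trace {N : Type*} [Fintype N] [DecidableEq N]
    (f : Matrix N N ℝ →ₗ[ℝ] ℝ) : ∃ Z : Matrix N N ℝ, ∀ X, f X = (X * Z).trace := by
  refine ⟨of fun i j => f (single j i 1), fun X => ?_⟩
  conv_lhs => rw [matrix_eq_sum_single X]
  simp only [map_sum, trace, diag_apply, Matrix.mul_apply, of_apply]
  refine Finset.sum_congr rfl fun i _ => Finset.sum_congr rfl fun j _ => ?_
  rw [← smul_eq_mul, ← map_smul]
  simp

/-- The strict Kalman-Yakubovich-Popov lemma for the pencil `K w = j ω E w`. -/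
theorem exists_strict_lmi {n N : Type*} [Fintype n] [Fintype N] [DecidableEq n] [DecidableEq N]
    (E K : Matrix n N ℝ) (H : Matrix N N ℝ) (hHs : Hᵀ = H)
    (hH : ∀ w : N → ℂ, w ≠ 0 → (E.map ofReal *ᵥ w = 0 ∨
      ∃ ω : ℝ, K.map ofReal *ᵥ w = (I * ω) • E.map ofReal *ᵥ w) →
      (star w ⬝ᵥ H.map ofReal *ᵥ w).re < 0) :
    ∃ P : Matrix n n ℝ, Pᵀ = P ∧
      ∀ w : N → ℝ, w ≠ 0 → 2 * (E *ᵥ w ⬝ᵥ P *ᵥ K *ᵥ w) + w ⬝ᵥ H *ᵥ w < 0 := by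
  by_contra! hcon
  -- The open convex cone `s` misses the affine space of all `L P + H`. A separating functional `f =
  -- tr(· Z)` is nonpositive on `s`, vanishes on the range of `L`, and has `f H ≥ u ≥ 0`. Matrices
  -- in `s` need not be symmetric, so `Z` is symmetrized to `S` below.
  set s : Set (Matrix N N ℝ) := {X | ∀ w : N → ℝ, w ≠ 0 → w ⬝ᵥ X *ᵥ w < 0} with hs
  set L : Matrix n n ℝ →ₗ[ℝ] Matrix N N ℝ :=
    { toFun := fun P => Eᵀ * (P + Pᵀ) * K + Kᵀ * (P + Pᵀ) * E
      map_add' := fun P Q => by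
        rw [transpose_add, add_add_add_comm]; simp only [Matrix.mul_add, Matrix.add_mul]; abel
      map_smul' := fun c P => by
        simp [← smul_add] } with hL
  have hLapp : ∀ P, L P = Eᵀ * (P + Pᵀ) * K + Kᵀ * (P + Pᵀ) * E := fun P => rfl
  have hconv : Convex ℝ s := by
    intro X hX Y hY a b ha hb hab w hw
    simp only [add_mulVec, smul_mulVec, dotProduct_add, dotProduct_smul, smul_eq_mul]
    have h1 := hX w hw
    have h2 := hY w hw
    rcases ha.eq_or_lt with rfl | ha
    · have : b = 1 := by linarith
      subst this; linarith
    · nlinarith [mul_neg_of_pos_of_neg ha h1, mul_nonpos_of_nonneg_of_nonpos hb h2.le]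
  have hconvt : Convex ℝ (Set.range fun P => L P + H) := by
    rintro _ ⟨P, rfl⟩ _ ⟨Q, rfl⟩ a b ha hb hab
    refine ⟨a • P + b • Q, ?_⟩
    simp only [map_add, map_smul, smul_add]
    have : H = a • H + b • H := by rw [← add_smul, hab, one_smul]
    conv_lhs => rw [this]
    abel
  have hdisj : Disjoint s (Set.range fun P => L P + H) := by
    rw [Set.disjoint_left]
    rintro _ hX ⟨P, rfl⟩
    obtain ⟨w, hw, hw'⟩ := hcon (P + Pᵀ) (by rw [transpose_add, transpose_transpose, add_comm])
    refine absurd (hX w hw) (not_lt.2 (hw'.trans_eq ?_))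
    change _ = w ⬝ᵥ (L P + H) *ᵥ w
    have hsym : (P + Pᵀ)ᵀ = P + Pᵀ := by rw [transpose_add, transpose_transpose, add_comm]
    rw [hLapp]
    generalize P + Pᵀ = R at hsym ⊢
    have e1 : w ⬝ᵥ (Eᵀ * R * K) *ᵥ w = E *ᵥ w ⬝ᵥ R *ᵥ K *ᵥ w := by
      rw [← mulVec_mulVec, ← mulVec_mulVec, dotProduct_mulVec, vecMul_transpose]
    have e2 : w ⬝ᵥ (Kᵀ * R * E) *ᵥ w = E *ᵥ w ⬝ᵥ R *ᵥ K *ᵥ w := by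
      rw [← mulVec_mulVec, ← mulVec_mulVec, dotProduct_mulVec, vecMul_transpose,
        dotProduct_mulVec, ← mulVec_transpose, hsym, dotProduct_comm]
    rw [add_mulVec, add_mulVec, dotProduct_add, dotProduct_add, e1, e2]
    ring
  obtain ⟨f, u, hfs, hft⟩ := geometric_hahn_banach_open hconv isOpen_negDef hconvt hdisj
  obtain ⟨Z, hZ⟩ := linear_functional_eq_trace (f : Matrix N N ℝ →ₗ[ℝ] ℝ)
  replace hZ : ∀ X, f X = (X * Z).trace := hZ
  have hscale : ∀ X ∈ s, ∀ t : ℝ, 0 < t → t * f X < u := fun X hX t ht => by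
    rw [← smul_eq_mul, ← map_smul]
    refine hfs _ fun w hw => ?_
    rw [smul_mulVec, dotProduct_smul, smul_eq_mul]
    exact mul_neg_of_pos_of_neg ht (hX w hw)
  have hfnonpos : ∀ X ∈ s, f X ≤ 0 := fun X hX => by
    by_contra! hc
    have := hscale X hX ((|u| + 1) / f X) (by positivity)
    rw [div_mul_cancel₀ _ hc.ne'] at this
    linarith [le_abs_self u]
  have hpos : ∀ w : N → ℝ, w ≠ 0 → 0 < w ⬝ᵥ w := fun w hw =>
    (dotProduct_self_star_nonneg (v := w)).lt_of_ne' (by simpa using hw)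
  have hone : ∀ t : ℝ, 0 < t → -(t • (1 : Matrix N N ℝ)) ∈ s := fun t ht w hw => by
    simp only [neg_mulVec, smul_mulVec, one_mulVec, dotProduct_neg, dotProduct_smul, smul_eq_mul]
    have := mul_pos ht (hpos w hw)
    linarith
  have hone' : (-1 : Matrix N N ℝ) ∈ s := by simpa using hone 1 one_pos
  have hu : 0 ≤ u := by
    by_contra! hu
    have h0 := hscale _ hone' 1 one_pos
    have hneg : f (-1) < 0 := by linarith
    have := hscale _ hone' (u / (2 * f (-1))) (div_pos_of_neg_of_neg hu (by linarith))
    have e : u / (2 * f (-1)) * f (-1) = u / 2 := by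
      have := hneg.ne
      field_simp
    linarith
  have hfL : ∀ P, f (L P) = 0 := fun P => by
    by_contra hne
    have := hft (L (((u - 1 - f H) / f (L P)) • P) + H) ⟨_, rfl⟩
    rw [map_add, map_smul, map_smul, smul_eq_mul, div_mul_cancel₀ _ hne] at this
    linarith
  have hfH : u ≤ f H := by simpa using hft (L 0 + H) ⟨0, rfl⟩
  set S := Z + Zᵀ with hS
  have hZnonneg : ∀ w : N → ℝ, 0 ≤ w ⬝ᵥ Z *ᵥ w := fun w => by
    have hvec : f (vecMulVec w w) = w ⬝ᵥ Z *ᵥ w := by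
      rw [hZ, trace_mul_comm, mul_vecMulVec, trace_vecMulVec, dotProduct_comm]
    rw [← hvec]
    by_contra! hc
    -- `-w wᵀ` is only negative semidefinite; `t` is positive, but so small that moving it into `s`
    -- costs at most half of `-f (vecMulVec w w)`.
    set t := -f (vecMulVec w w) / (2 * (|f 1| + 1)) with ht
    have htpos : 0 < t := by rw [ht]; apply div_pos <;> [linarith; positivity]
    have hmem : -vecMulVec w w - t • (1 : Matrix N N ℝ) ∈ s := fun v hv => by
      have h1 := hone t htpos v hv
      rw [sub_eq_add_neg, add_mulVec, dotProduct_add]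
      have h2 : v ⬝ᵥ (-vecMulVec w w) *ᵥ v ≤ 0 := by
        rw [neg_mulVec, vecMulVec_mulVec, dotProduct_neg, neg_nonpos]
        simp only [op_smul_eq_smul, dotProduct_smul, smul_eq_mul]
        rw [dotProduct_comm w v]
        exact mul_self_nonneg _
      linarith
    have h3 := hfnonpos _ hmem
    rw [map_sub, map_neg, map_smul, smul_eq_mul] at h3
    have h4 : t * f 1 ≤ -f (vecMulVec w w) / 2 := by
      have : t * (|f 1| + 1) = -f (vecMulVec w w) / 2 := by rw [ht]; field_simp
      nlinarith [le_abs_self (f 1)]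
    linarith
  have hSpsd : S.PosSemidef := by
    refine PosSemidef.of_dotProduct_mulVec_nonneg ?_ fun w => ?_
    · rw [IsHermitian, conjTranspose_eq_transpose_of_trivial, hS, transpose_add,
        transpose_transpose, add_comm]
    · rw [star_trivial, hS, add_mulVec, dotProduct_add, mulVec_transpose, dotProduct_comm w (w ᵥ* Z),
        ← dotProduct_mulVec]
      linarith [hZnonneg w]
  obtain ⟨k, V, hSV⟩ := exists_eq_mul_transpose hSpsd
  have hskew : K * S * Eᵀ + E * S * Kᵀ = 0 := by
    obtain ⟨Q, hQ⟩ : ∃ Q, Q = K * Z * Eᵀ + E * Z * Kᵀ := ⟨_, rfl⟩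
    have hQS : Q + Qᵀ = K * S * Eᵀ + E * S * Kᵀ := by
      rw [hQ, hS]
      simp only [transpose_add, transpose_mul, transpose_transpose, Matrix.mul_add,
        Matrix.add_mul, Matrix.mul_assoc]
      abel
    have htrace : ∀ P, f (L P) = (P * (Q + Qᵀ)).trace := fun P => by
      have h1 : f (L P) = ((P + Pᵀ) * Q).trace := by
        rw [hZ, hLapp]
        generalize P + Pᵀ = R
        rw [Matrix.add_mul, trace_add, hQ, Matrix.mul_add, trace_add]
        congr 1
        · rw [show Eᵀ * R * K * Z = Eᵀ * (R * (K * Z)) by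
            simp only [Matrix.mul_assoc], trace_mul_comm]
          simp only [Matrix.mul_assoc]
        · rw [show Kᵀ * R * E * Z = Kᵀ * (R * (E * Z)) by
            simp only [Matrix.mul_assoc], trace_mul_comm]
          simp only [Matrix.mul_assoc]
      rw [h1, Matrix.add_mul, Matrix.mul_add, trace_add, trace_add]
      congr 1
      rw [← trace_transpose, transpose_mul, transpose_transpose, trace_mul_comm]
    -- Testing `f ∘ L = 0` at this matrix gives the squared Frobenius norm of `Q + Qᵀ`.
    have h0 := htrace (Q + Qᵀ)ᵀ
    rw [hfL, ← conjTranspose_eq_transpose_of_trivial] at h0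
    rw [← hQS]
    exact trace_conjTranspose_mul_self_eq_zero_iff.1 h0.symm
  have main := re_trace_neg_of_skew (E.map ofReal) (K.map ofReal) (H.map ofReal) (V.map ofReal)
    (by
      simp only [← map_ofReal_mul, conjTranspose_map_ofReal, ← map_ofReal_add]
      have : K * V * (E * V)ᵀ + E * V * (K * V)ᵀ = 0 := by
        rw [← hskew, hSV]
        simp only [transpose_mul, Matrix.mul_assoc]
      rw [this]
      ext i j
      simp) hH
  have hHS : (H * S).trace = 2 * f H := by
    have : (H * Zᵀ).trace = (H * Z).trace := by
      rw [← trace_transpose, transpose_mul, transpose_transpose, hHs, trace_mul_comm]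
    rw [hS, Matrix.mul_add, trace_add, this, ← hZ]
    ring
  have htr : (((V.map ofReal)ᴴ * H.map ofReal * V.map ofReal).trace).re = 2 * f H := by
    rw [conjTranspose_map_ofReal, ← map_ofReal_mul, ← map_ofReal_mul, trace_map_ofReal, ofReal_re,
      ← hHS, hSV, Matrix.mul_assoc, trace_mul_comm, Matrix.mul_assoc]
  rw [htr] at main
  -- If `V = 0`, then `f (-1) = 0` and `f H = 0`, contradicting `f (-1) < u ≤ f H`. Otherwise `2 * f
  -- H` is negative, contradicting `0 ≤ u ≤ f H`.
  by_cases hV0 : V = 0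
  · have hS0 : S = 0 := by rw [hSV, hV0, Matrix.zero_mul]
    have h1 : Z.trace = 0 := by
      have : S.trace = 2 * Z.trace := by rw [hS, trace_add, trace_transpose]; ring
      rw [hS0, trace_zero] at this
      linarith
    have h2 := hfs _ hone'
    rw [hZ, Matrix.neg_mul, Matrix.one_mul, trace_neg, h1] at h2
    rw [hS0, Matrix.mul_zero, trace_zero] at hHS
    linarith
  · have := main.2 (fun h => hV0 (by ext i j; simpa using congrFun (congrFun h i) j))
    linarith

end NegImag

/-! ### The nonstrict KYP lemma by compactness -/

namespace NegImag

open Matrix Complex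

section

open Filter Topology

attribute [local instance] Matrix.normedAddCommGroup Matrix.normedSpace

/-- A closure argument: approximate solutions of a linear matrix inequality yield a solution,
provided that its recession cone is trivial. -/
theorem exists_lmi_of_approx {n N : Type*} [Fintype n] [Fintype N]
    (E K : Matrix n N ℝ) (H : Matrix N N ℝ)
    (hrec : ∀ Q : Matrix n n ℝ, Qᵀ = Q → (∀ w, E *ᵥ w ⬝ᵥ Q *ᵥ K *ᵥ w ≤ 0) → Q = 0)
    (happ : ∀ ε : ℝ, 0 < ε → ∃ P : Matrix n n ℝ, Pᵀ = P ∧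
      ∀ w, 2 * (E *ᵥ w ⬝ᵥ P *ᵥ K *ᵥ w) + w ⬝ᵥ H *ᵥ w ≤ ε * (w ⬝ᵥ w)) :
    ∃ P : Matrix n n ℝ, Pᵀ = P ∧ ∀ w, 2 * (E *ᵥ w ⬝ᵥ P *ᵥ K *ᵥ w) + w ⬝ᵥ H *ᵥ w ≤ 0 := by
  have hcont : ∀ w : N → ℝ, Continuous fun P : Matrix n n ℝ => E *ᵥ w ⬝ᵥ P *ᵥ K *ᵥ w :=
    fun w => by fun_prop
  have hsymc : IsClosed {P : Matrix n n ℝ | Pᵀ = P} :=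
    isClosed_eq continuous_id.matrix_transpose continuous_id
  have hww : ∀ w : N → ℝ, 0 ≤ w ⬝ᵥ w := fun w => dotProduct_self_star_nonneg (v := w)
  choose P hPs hP using fun k : ℕ => happ (1 / ((k : ℝ) + 1)) (by positivity)
  have hP1 : ∀ k w, 2 * (E *ᵥ w ⬝ᵥ P k *ᵥ K *ᵥ w) ≤ w ⬝ᵥ w - w ⬝ᵥ H *ᵥ w := fun k w => by
    have h1 : 1 / ((k : ℝ) + 1) ≤ 1 := by
      rw [div_le_one (by positivity)]; linarith [(Nat.cast_nonneg k : (0 : ℝ) ≤ k)]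
    nlinarith [hP k w, hww w]
  have hbdd : ∃ c, ∀ k, ‖P k‖ ≤ c := by
    -- Along an unbounded subsequence, the normalized `P` accumulate at some `Q` of norm 1. Dividing
    -- `hP1` by the norm kills its right side in the limit, so `Q` is a recession direction and must
    -- vanish.
    by_contra! hc
    choose φ hφ using fun j : ℕ => hc ((j : ℝ) + 1)
    have hpos : ∀ j, 0 < ‖P (φ j)‖ := fun j => lt_trans (by positivity) (hφ j)
    obtain ⟨Q, hQ, ψ, hψ, hlim⟩ := (isCompact_sphere (0 : Matrix n n ℝ) 1).tendsto_subseq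
      (x := fun j => ‖P (φ j)‖⁻¹ • P (φ j)) (fun j => by simp [norm_smul, (hpos j).ne'])
    have hQ0 : Q = 0 := by
      refine hrec Q (hsymc.mem_of_tendsto hlim (Eventually.of_forall fun j => ?_)) fun w => ?_
      · simp [hPs]
      · have h1 : Tendsto (fun j => ‖P (φ (ψ j))‖⁻¹ * ((w ⬝ᵥ w - w ⬝ᵥ H *ᵥ w) / 2)) atTop
            (𝓝 (0 * ((w ⬝ᵥ w - w ⬝ᵥ H *ᵥ w) / 2))) := by
          refine Tendsto.mul_const _ (tendsto_inv_atTop_zero.comp ?_)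
          refine Tendsto.comp (g := fun j => ‖P (φ j)‖) ?_ hψ.tendsto_atTop
          refine tendsto_atTop_mono (fun j => ?_) tendsto_natCast_atTop_atTop
          linarith [hφ j]
        rw [zero_mul] at h1
        refine le_of_tendsto_of_tendsto' (((hcont w).tendsto Q).comp hlim) h1 fun j => ?_
        simp only [Function.comp_apply, smul_mulVec, dotProduct_smul, smul_eq_mul]
        have := hP1 (φ (ψ j)) w
        have h2 := inv_pos.2 (hpos (ψ j))
        exact mul_le_mul_of_nonneg_left (by linarith) h2.le
    simp [hQ0] at hQ
  obtain ⟨c, hc⟩ := hbdd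
  obtain ⟨Q, -, ψ, hψ, hlim⟩ := tendsto_subseq_of_bounded
    (Metric.isBounded_closedBall (x := (0 : Matrix n n ℝ)) (r := c)) (x := P)
    (fun k => by simpa using hc k)
  refine ⟨Q, hsymc.mem_of_tendsto hlim (Eventually.of_forall fun j => hPs _), fun w => ?_⟩
  have h1 : Tendsto (fun j => 1 / ((ψ j : ℝ) + 1) * (w ⬝ᵥ w)) atTop (𝓝 (0 * (w ⬝ᵥ w))) :=
    ((tendsto_one_div_add_atTop_nhds_zero_nat (𝕜 := ℝ)).comp hψ.tendsto_atTop).mul_const _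
  rw [zero_mul] at h1
  exact le_of_tendsto_of_tendsto'
    (((((hcont w).tendsto Q).comp hlim).const_mul 2).add_const _) h1 fun j => hP (ψ j) w

end

/-- The nonstrict Kalman-Yakubovich-Popov lemma for the pencil `K w = j ω E w`. -/
theorem exists_lmi {n N : Type*} [Fintype n] [Fintype N] [DecidableEq n] [DecidableEq N]
    (E K : Matrix n N ℝ) (H : Matrix N N ℝ) (hHs : Hᵀ = H)
    (hrec : ∀ Q : Matrix n n ℝ, Qᵀ = Q → (∀ w, E *ᵥ w ⬝ᵥ Q *ᵥ K *ᵥ w ≤ 0) → Q = 0)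
    (hH : ∀ w : N → ℂ, (E.map ofReal *ᵥ w = 0 ∨
      ∃ ω : ℝ, K.map ofReal *ᵥ w = (I * ω) • E.map ofReal *ᵥ w) →
      (star w ⬝ᵥ H.map ofReal *ᵥ w).re ≤ 0) :
    ∃ P : Matrix n n ℝ, Pᵀ = P ∧ ∀ w, 2 * (E *ᵥ w ⬝ᵥ P *ᵥ K *ᵥ w) + w ⬝ᵥ H *ᵥ w ≤ 0 := by
  refine exists_lmi_of_approx E K H hrec fun ε hε => ?_
  obtain ⟨P, hPs, hP⟩ := exists_strict_lmi E K (H - ε • 1) (by simp [hHs]) fun w hw hadm => by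
    have hmap : (H - ε • (1 : Matrix N N ℝ)).map ofReal = H.map ofReal - (ε : ℂ) • 1 := by
      ext i j
      by_cases h : i = j <;> simp [h]
    rw [hmap, sub_mulVec, dotProduct_sub, smul_mulVec, one_mulVec, dotProduct_smul, sub_re,
      smul_eq_mul, re_ofReal_mul]
    have h1 : 0 < (star w ⬝ᵥ w).re := by
      have : 0 < star w ⬝ᵥ w := dotProduct_star_self_pos_iff.2 hw
      exact (Complex.pos_iff.1 this).1
    nlinarith [hH w hadm, mul_pos hε h1]
  refine ⟨P, hPs, fun w => ?_⟩
  by_cases hw : w = 0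
  · simp [hw]
  · have := hP w hw
    rw [sub_mulVec, dotProduct_sub, smul_mulVec, one_mulVec, dotProduct_smul, smul_eq_mul] at this
    linarith

/-- For a controllable pair, the recession cone of the inequality is trivial. -/
theorem eq_zero_of_recession {n m : Type*} [Fintype n] [Fintype m] [DecidableEq n]
    (A : Matrix n n ℝ) (B : Matrix n m ℝ)
    (hctrl : ∀ Q : Matrix n n ℝ, (∀ k : ℕ, Q * (A ^ k * B) = 0) → Q = 0)
    (Q : Matrix n n ℝ) (hQ : Qᵀ = Q)
    (h : ∀ (x : n → ℝ) (u : m → ℝ), x ⬝ᵥ Q *ᵥ (A *ᵥ x + B *ᵥ u) ≤ 0) : Q = 0 := by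
  have hsymm : ∀ x y : n → ℝ, x ⬝ᵥ Q *ᵥ y = y ⬝ᵥ Q *ᵥ x := fun x y => by
    rw [dotProduct_mulVec, ← mulVec_transpose, hQ, dotProduct_comm]
  have hlin : ∀ a b : ℝ, (∀ t : ℝ, a + t * b ≤ 0) → b = 0 := fun a b hab => by
    by_contra hb
    have := hab ((1 - a) / b)
    rw [div_mul_cancel₀ _ hb] at this
    linarith
  -- The inequality is affine in `u`, and an affine function bounded above has slope zero. The same
  -- argument along `x + t • y` with `Q y = 0` makes the kernel of `Q` invariant under `A`.
  have hB : ∀ (x : n → ℝ) (u : m → ℝ), x ⬝ᵥ Q *ᵥ B *ᵥ u = 0 := fun x u =>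
    hlin (x ⬝ᵥ Q *ᵥ A *ᵥ x) _ fun t => by
      have := h x (t • u)
      rwa [mulVec_add, dotProduct_add, mulVec_smul, mulVec_smul, dotProduct_smul,
        smul_eq_mul] at this
  have hstep : ∀ y : n → ℝ, Q *ᵥ y = 0 → Q *ᵥ A *ᵥ y = 0 := fun y hy => by
    refine dotProduct_eq_zero _ fun x => ?_
    rw [dotProduct_comm]
    refine hlin (x ⬝ᵥ Q *ᵥ A *ᵥ x) _ fun t => ?_
    have h1 := h (x + t • y) 0
    have h2 : ∀ z, y ⬝ᵥ Q *ᵥ z = 0 := fun z => by rw [hsymm, hy, dotProduct_zero]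
    simpa only [mulVec_add, mulVec_smul, add_dotProduct, dotProduct_add, h2, mulVec_zero,
      dotProduct_zero, smul_dotProduct, dotProduct_smul, smul_eq_mul, mul_zero, add_zero] using h1
  refine hctrl Q fun k => ?_
  have key : ∀ u, Q *ᵥ (A ^ k * B) *ᵥ u = 0 := fun u => by
    induction k with
    | zero =>
      rw [pow_zero, Matrix.one_mul]
      refine dotProduct_eq_zero _ fun x => ?_
      rw [dotProduct_comm, hB]
    | succ k ih =>
      rw [pow_succ', Matrix.mul_assoc, ← mulVec_mulVec]
      exact hstep _ ih
  ext i j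
  classical
  have := congrFun (key (Pi.single j 1)) i
  rw [mulVec_mulVec] at this
  simpa using this

end NegImag

/-! ### Hurwitz matrices and Lyapunov inequalities -/

namespace NegImag

open Matrix Complex

section

open Filter Topology ENNReal NNReal

attribute [local instance] Matrix.linftyOpNormedRing Matrix.linftyOpNormedAlgebra

theorem mem_spectrum_iff_exists_mulVec {n : Type*} [Fintype n] [DecidableEq n]
    (A : Matrix n n ℂ) (z : ℂ) : z ∈ spectrum ℂ A ↔ ∃ v ≠ 0, A *ᵥ v = z • v := by
  rw [spectrum.mem_iff, Matrix.isUnit_iff_isUnit_det, isUnit_iff_ne_zero, not_not,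
    ← exists_mulVec_eq_zero_iff]
  refine exists_congr fun v => and_congr_right fun _ => ?_
  rw [sub_mulVec, sub_eq_zero, eq_comm, Algebra.algebraMap_eq_smul_one, smul_mulVec, one_mulVec]

/-- Gelfand's formula: the spectral radius is below some `r < 1`, so eventually `‖T ^ k‖ ≤ r ^ k`.
-/
theorem tendsto_pow_zero {n : Type*} [Fintype n] [DecidableEq n]
    (T : Matrix n n ℂ) (hT : ∀ (z : ℂ) (v : n → ℂ), v ≠ 0 → T *ᵥ v = z • v → ‖z‖ < 1) :
    Tendsto (fun k : ℕ => T ^ k) atTop (𝓝 0) := by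
  rcases isEmpty_or_nonempty n with hn | hn
  · exact tendsto_const_nhds.congr fun k => Subsingleton.elim _ _
  have hr : spectralRadius ℂ T < (1 : ℝ≥0) := by
    refine spectrum.spectralRadius_lt_of_forall_lt_of_nonempty (spectrum.nonempty T) fun z hz => ?_
    obtain ⟨v, hv, hz⟩ := (mem_spectrum_iff_exists_mulVec T z).1 hz
    exact hT z v hv hz
  obtain ⟨r, hr1, hr2⟩ := ENNReal.lt_iff_exists_nnreal_btwn.1 hr
  have h := (spectrum.pow_nnnorm_pow_one_div_tendsto_nhds_spectralRadius T).eventually_lt_const hr1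
  have hr2' : r < 1 := by exact_mod_cast hr2
  refine tendsto_zero_iff_norm_tendsto_zero.2 ?_
  refine squeeze_zero' (Eventually.of_forall fun k => norm_nonneg _) ?_
    (tendsto_pow_atTop_nhds_zero_of_lt_one r.2 (by exact_mod_cast hr2'))
  filter_upwards [h, eventually_gt_atTop 0] with k hk hk0
  have h1 : ((‖T ^ k‖₊ : ℝ≥0∞) ^ (1 / k : ℝ)) ^ (k : ℝ) ≤ (r : ℝ≥0∞) ^ (k : ℝ) :=
    ENNReal.rpow_le_rpow hk.le (by positivity)
  rw [← ENNReal.rpow_mul, one_div_mul_cancel (by positivity), ENNReal.rpow_one,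
    ENNReal.rpow_natCast] at h1
  exact_mod_cast h1

end

/-- All eigenvalues of the real matrix `A` lie in the open left half plane. -/
def IsHurwitz {n : Type*} [Fintype n] (A : Matrix n n ℝ) : Prop :=
  ∀ (z : ℂ) (v : n → ℂ), v ≠ 0 → A.map ofReal *ᵥ v = z • v → z.re < 0

theorem IsHurwitz.det_ne_zero {n : Type*} [Fintype n] [DecidableEq n] {A : Matrix n n ℝ}
    (hA : IsHurwitz A) {z : ℂ} (hz : 0 ≤ z.re) : (z • 1 - A.map ofReal).det ≠ 0 := by
  intro h
  obtain ⟨v, hv, hv'⟩ := exists_mulVec_eq_zero_iff.2 h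
  refine not_lt.2 hz (hA z v hv ?_)
  rw [sub_mulVec, smul_mulVec, one_mulVec, sub_eq_zero] at hv'
  exact hv'.symm

theorem det_map_ofReal {n : Type*} [Fintype n] [DecidableEq n] (A : Matrix n n ℝ) :
    (A.map ofReal).det = (A.det : ℂ) :=
  (RingHom.map_det Complex.ofRealHom A).symm

theorem map_ofReal_one {n : Type*} [DecidableEq n] :
    (1 : Matrix n n ℝ).map ofReal = 1 := Matrix.map_one _ ofReal_zero ofReal_one

theorem map_ofReal_pow {n : Type*} [Fintype n] [DecidableEq n] (A : Matrix n n ℝ) (k : ℕ) :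
    (A ^ k).map ofReal = A.map ofReal ^ k := by
  induction k with
  | zero => simp
  | succ k ih => rw [pow_succ, pow_succ, map_ofReal_mul, ih]

/-- A solution of a Lyapunov inequality with Hurwitz system matrix is positive semidefinite. -/
theorem IsHurwitz.nonneg_of_lyapunov {n : Type*} [Fintype n] [DecidableEq n] {A : Matrix n n ℝ}
    (hA : IsHurwitz A) {P : Matrix n n ℝ} (hP : Pᵀ = P)
    (h : ∀ x, x ⬝ᵥ P *ᵥ A *ᵥ x ≤ 0) (x : n → ℝ) : 0 ≤ x ⬝ᵥ P *ᵥ x := by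
  have hsymm : ∀ x y : n → ℝ, x ⬝ᵥ P *ᵥ y = y ⬝ᵥ P *ᵥ x := fun x y => by
    rw [dotProduct_mulVec, ← mulVec_transpose, hP, dotProduct_comm]
  have hdet : IsUnit (1 - A).det := by
    have := hA.det_ne_zero (z := 1) (by simp)
    rw [one_smul, ← map_ofReal_one, ← Matrix.map_sub ofReal (by simp), det_map_ofReal] at this
    exact isUnit_iff_ne_zero.2 (by exact_mod_cast this)
  -- The Cayley transform turns the continuous-time inequality into a discrete one: for `x = (1 - A)
  -- y` the form of `P` changes by `4 (y ⬝ P A y) ≤ 0`. It maps the open left half plane into the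
  -- unit disc, so `T ^ k → 0` and the form decreases to 0 along the powers.
  set T := (1 + A) * (1 - A)⁻¹ with hT
  have hstep : ∀ x, T *ᵥ x ⬝ᵥ P *ᵥ T *ᵥ x ≤ x ⬝ᵥ P *ᵥ x := fun x => by
    set y := (1 - A)⁻¹ *ᵥ x with hy
    have hx : x = y - A *ᵥ y := by
      have : (1 - A) *ᵥ y = x := by
        rw [hy, mulVec_mulVec, Matrix.mul_nonsing_inv _ hdet, one_mulVec]
      rw [← this, sub_mulVec, one_mulVec]
    have hTx : T *ᵥ x = y + A *ᵥ y := by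
      rw [hT, ← mulVec_mulVec, ← hy, add_mulVec, one_mulVec]
    rw [hTx, hx]
    simp only [mulVec_add, mulVec_sub, add_dotProduct, sub_dotProduct, dotProduct_add,
      dotProduct_sub]
    linarith [h y, hsymm (A *ᵥ y) y]
  have hpow : ∀ k : ℕ, T ^ k *ᵥ x ⬝ᵥ P *ᵥ T ^ k *ᵥ x ≤ x ⬝ᵥ P *ᵥ x := fun k => by
    induction k with
    | zero => simp
    | succ k ih =>
      refine le_trans ?_ ih
      rw [pow_succ', ← mulVec_mulVec]
      exact hstep _
  have hlim := tendsto_pow_zero (T.map ofReal) fun z v hv hz => by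
    set B := A.map ofReal
    have hTB : T.map ofReal * (1 - B) = 1 + B := by
      rw [← map_ofReal_one, ← Matrix.map_sub ofReal (by simp), ← map_ofReal_mul,
        ← map_ofReal_add, hT, Matrix.mul_assoc, Matrix.nonsing_inv_mul _ hdet, Matrix.mul_one]
    have hBdet : IsUnit (1 - B).det := by
      have := hA.det_ne_zero (z := 1) (by simp)
      rw [one_smul] at this
      exact isUnit_iff_ne_zero.2 this
    set y := (1 - B)⁻¹ *ᵥ v with hy
    have hvy : v = (1 - B) *ᵥ y := by
      rw [hy, mulVec_mulVec, Matrix.mul_nonsing_inv _ hBdet, one_mulVec]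
    have hy0 : y ≠ 0 := fun h0 => hv (by rw [hvy, h0, mulVec_zero])
    rw [hvy, mulVec_mulVec, hTB, add_mulVec, sub_mulVec, one_mulVec, smul_sub] at hz
    have h1 : (1 + z) • B *ᵥ y = (z - 1) • y := by
      rw [add_smul, sub_smul, one_smul, one_smul]
      linear_combination (exp := 1) hz
    have hz1 : 1 + z ≠ 0 := fun h0 => by
      rw [h0, zero_smul] at h1
      rcases smul_eq_zero.1 h1.symm with h2 | h2
      · have : (2 : ℂ) = 0 := by linear_combination h0 - h2
        norm_num at this
      · exact hy0 h2
    have h2 : B *ᵥ y = ((z - 1) / (1 + z)) • y := by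
      rw [div_eq_inv_mul, mul_smul, ← h1, smul_smul, inv_mul_cancel₀ hz1, one_smul]
    have h3 := hA _ y hy0 h2
    have h4 : 0 < normSq (1 + z) := normSq_pos.2 hz1
    rw [Complex.div_re, ← add_div, div_lt_iff₀ h4, zero_mul] at h3
    simp only [sub_re, add_re, one_re, sub_im, add_im, one_im] at h3
    rw [← sq_lt_one_iff₀ (norm_nonneg _), Complex.sq_norm, normSq_apply]
    nlinarith
  have hlimR : Filter.Tendsto (fun k : ℕ => T ^ k) Filter.atTop (nhds 0) := by
    have hre : Continuous fun M : Matrix n n ℂ => M.map re := continuous_id.matrix_map continuous_re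
    have := (hre.tendsto 0).comp hlim
    refine (this.congr fun k => ?_).trans_eq ?_
    · rw [Function.comp_apply, ← map_ofReal_pow]; ext i j; simp
    · congr 1
  have hc : Continuous fun M : Matrix n n ℝ => M *ᵥ x ⬝ᵥ P *ᵥ M *ᵥ x := by fun_prop
  have := (hc.tendsto 0).comp hlimR
  simp only [zero_mulVec, mulVec_zero, dotProduct_zero] at this
  exact le_of_tendsto' this hpow

end NegImag

/-! ### The positive real lemma and the construction of `Y` -/

namespace NegImag

open Matrix Complex

theorem eq_zero_of_forall_smul_add_sq_nonpos {a b : ℝ} (h : ∀ t : ℝ, t * a + t ^ 2 * b ≤ 0) :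
    a = 0 := by
  by_contra ha
  have hb : 0 < |b| + 1 := by positivity
  have h1 := h (a / (2 * (|b| + 1)))
  have h2 : a / (2 * (|b| + 1)) * a + (a / (2 * (|b| + 1))) ^ 2 * b
      = a ^ 2 / (4 * (|b| + 1) ^ 2) * (2 * (|b| + 1) + b) := by
    field_simp
    ring
  rw [h2] at h1
  have h3 : 0 < 2 * (|b| + 1) + b := by linarith [neg_abs_le b, abs_nonneg b]
  have h4 : 0 < a ^ 2 / (4 * (|b| + 1) ^ 2) := by positivity
  linarith [mul_pos h4 h3]

theorem re_star_dotProduct_transpose {N : Type*} [Fintype N] (G : Matrix N N ℝ) (w : N → ℂ) :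
    (star w ⬝ᵥ Gᵀ.map ofReal *ᵥ w).re = (star w ⬝ᵥ G.map ofReal *ᵥ w).re := by
  rw [← conjTranspose_map_ofReal, ← Complex.conj_re (star w ⬝ᵥ G.map ofReal *ᵥ w)]
  congr 1
  change _ = star (star w ⬝ᵥ G.map ofReal *ᵥ w)
  rw [← star_dotProduct, star_mulVec, ← dotProduct_mulVec]

variable {n m : Type*} [Fintype n] [Fintype m] [DecidableEq n] [DecidableEq m]

/-- The positive real lemma for `s C (s I - A)⁻¹ B`, whose storage inequality is
`(P x - Cᵀ u) ⬝ (A x + B u) ≤ 0`. -/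
theorem exists_storage (A : Matrix n n ℝ) (B : Matrix n m ℝ) (C : Matrix m n ℝ)
    (hctrl : ∀ Q : Matrix n n ℝ, (∀ k : ℕ, Q * (A ^ k * B) = 0) → Q = 0)
    (hinf : ∀ u : m → ℂ, 0 ≤ (star u ⬝ᵥ C.map ofReal *ᵥ B.map ofReal *ᵥ u).re)
    (hfreq : ∀ (ω : ℝ) (x : n → ℂ) (u : m → ℂ),
      A.map ofReal *ᵥ x + B.map ofReal *ᵥ u = (I * ω) • x →
      0 ≤ (I * ω * (star u ⬝ᵥ C.map ofReal *ᵥ x)).re) :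
    ∃ P : Matrix n n ℝ, Pᵀ = P ∧
      ∀ (x : n → ℝ) (u : m → ℝ), (P *ᵥ x - Cᵀ *ᵥ u) ⬝ᵥ (A *ᵥ x + B *ᵥ u) ≤ 0 := by
  -- For `w = (x, u)`, `E w` is the state, `K w` its derivative and `F w` the input. The condition
  -- `K w = jω E w` is the state equation at frequency `ω`, and `E w = 0` plays the role of infinite
  -- frequency. The form of `G` is the supply rate `u ⬝ C (A x + B u)`.
  set E : Matrix n (n ⊕ m) ℝ := fromCols 1 0 with hE
  set K : Matrix n (n ⊕ m) ℝ := fromCols A B with hK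
  set F : Matrix m (n ⊕ m) ℝ := fromCols 0 1 with hF
  set G := Fᵀ * C * K with hG
  have hmapE : E.map ofReal = fromCols 1 0 := by
    ext i j; rcases j with j | j <;> simp [hE, Matrix.one_apply, apply_ite ofReal]
  have hmapK : K.map ofReal = fromCols (A.map ofReal) (B.map ofReal) := by
    ext i j; rcases j with j | j <;> simp [hK]
  have hmapF : F.map ofReal = fromCols 0 1 := by
    ext i j; rcases j with j | j <;> simp [hF, Matrix.one_apply, apply_ite ofReal]
  have hEw : ∀ w, E *ᵥ w = w ∘ Sum.inl := fun w => by simp [hE, fromCols_mulVec]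
  have hKw : ∀ w, K *ᵥ w = A *ᵥ (w ∘ Sum.inl) + B *ᵥ (w ∘ Sum.inr) := fun w => by
    simp [hK, fromCols_mulVec]
  have hFw : ∀ w, F *ᵥ w = w ∘ Sum.inr := fun w => by simp [hF, fromCols_mulVec]
  have hGw : ∀ w, w ⬝ᵥ G *ᵥ w
      = (w ∘ Sum.inr) ⬝ᵥ C *ᵥ (A *ᵥ (w ∘ Sum.inl) + B *ᵥ (w ∘ Sum.inr)) := fun w => by
    rw [hG, ← mulVec_mulVec, hKw, ← mulVec_mulVec, dotProduct_mulVec, vecMul_transpose, hFw]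
  have hGw' : ∀ w : n ⊕ m → ℂ, star w ⬝ᵥ G.map ofReal *ᵥ w
      = star (w ∘ Sum.inr) ⬝ᵥ C.map ofReal *ᵥ K.map ofReal *ᵥ w := fun w => by
    rw [hG, map_ofReal_mul, map_ofReal_mul, ← mulVec_mulVec, ← mulVec_mulVec,
      ← conjTranspose_map_ofReal, dotProduct_mulVec, ← star_mulVec, hmapF]
    simp [fromCols_mulVec]
  obtain ⟨P, hPs, hP⟩ := exists_lmi E K (-(G + Gᵀ))
    (by rw [transpose_neg, transpose_add, transpose_transpose, add_comm])
    (fun Q hQ h => eq_zero_of_recession A B hctrl Q hQ fun x u => by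
      have := h (Sum.elim x u)
      rwa [hEw, hKw, Sum.elim_comp_inl, Sum.elim_comp_inr] at this)
    (fun w hw => by
      have hmap : (-(G + Gᵀ)).map ofReal = -(G.map ofReal + Gᵀ.map ofReal) := by
        ext i j; simp
      rw [hmap, neg_mulVec, dotProduct_neg, add_mulVec, dotProduct_add, neg_re, add_re,
        re_star_dotProduct_transpose, hGw']
      have hmapEw : E.map ofReal *ᵥ w = w ∘ Sum.inl := by
        rw [hmapE]; simp [fromCols_mulVec]
      have hmapKw : K.map ofReal *ᵥ w = A.map ofReal *ᵥ (w ∘ Sum.inl)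
          + B.map ofReal *ᵥ (w ∘ Sum.inr) := by
        rw [hmapK]; simp [fromCols_mulVec]
      rw [hmapEw] at hw
      rcases hw with hw | ⟨ω, hw⟩
      · rw [hmapKw, hw, mulVec_zero, zero_add]
        linarith [hinf (w ∘ Sum.inr)]
      · rw [hw, mulVec_smul, dotProduct_smul, smul_eq_mul]
        rw [hmapKw] at hw
        linarith [hfreq ω _ _ hw])
  refine ⟨P, hPs, fun x u => ?_⟩
  have h1 := hP (Sum.elim x u)
  rw [neg_mulVec, dotProduct_neg, add_mulVec, dotProduct_add, mulVec_transpose,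
    dotProduct_comm _ (_ ᵥ* _), ← dotProduct_mulVec, hGw, hEw, hKw, Sum.elim_comp_inl,
    Sum.elim_comp_inr] at h1
  have h2 : P *ᵥ x ⬝ᵥ (A *ᵥ x + B *ᵥ u) = x ⬝ᵥ P *ᵥ (A *ᵥ x + B *ᵥ u) := by
    rw [dotProduct_mulVec, ← mulVec_transpose, hPs]
  have h3 : Cᵀ *ᵥ u ⬝ᵥ (A *ᵥ x + B *ᵥ u) = u ⬝ᵥ C *ᵥ (A *ᵥ x + B *ᵥ u) := by
    rw [dotProduct_mulVec, ← mulVec_transpose]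
  rw [sub_dotProduct, h2, h3]
  linarith

/-- The storage inequality at `u = 0` is a Lyapunov inequality, so `P ≥ 0`. Its equality case at
equilibria yields `Cᵀ = -P A⁻¹ B`, which becomes `B + A Y Cᵀ = 0` for `Y = P⁻¹`. -/
theorem exists_posDef_of_freq (A : Matrix n n ℝ) (B : Matrix n m ℝ) (C : Matrix m n ℝ)
    (hA : IsHurwitz A)
    (hctrl : ∀ Q : Matrix n n ℝ, (∀ k : ℕ, Q * (A ^ k * B) = 0) → Q = 0)
    (hobs : ∀ x : n → ℝ, (∀ k : ℕ, C *ᵥ A ^ k *ᵥ x = 0) → x = 0)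
    (hinf : ∀ u : m → ℂ, 0 ≤ (star u ⬝ᵥ C.map ofReal *ᵥ B.map ofReal *ᵥ u).re)
    (hfreq : ∀ (ω : ℝ) (x : n → ℂ) (u : m → ℂ),
      A.map ofReal *ᵥ x + B.map ofReal *ᵥ u = (I * ω) • x →
      0 ≤ (I * ω * (star u ⬝ᵥ C.map ofReal *ᵥ x)).re) :
    ∃ Y : Matrix n n ℝ, Y.PosDef ∧ (-(A * Y + Y * Aᵀ)).PosSemidef ∧ B + A * Y * Cᵀ = 0 := by
  obtain ⟨P, hPs, hP⟩ := exists_storage A B C hctrl hinf hfreq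
  have hAdet : IsUnit A.det := by
    have := hA.det_ne_zero (z := 0) le_rfl
    rw [zero_smul, zero_sub, det_neg, det_map_ofReal] at this
    refine isUnit_iff_ne_zero.2 fun h => this ?_
    simp [h]
  have hmove : ∀ x y : n → ℝ, P *ᵥ x ⬝ᵥ y = x ⬝ᵥ P *ᵥ y := fun x y => by
    rw [dotProduct_mulVec, ← mulVec_transpose, hPs]
  have hlyap : ∀ x, x ⬝ᵥ P *ᵥ A *ᵥ x ≤ 0 := fun x => by
    simpa only [mulVec_zero, sub_zero, add_zero, hmove] using hP x 0
  have hnonneg := hA.nonneg_of_lyapunov hPs hlyap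
  -- At an equilibrium `A x + B u = 0` the storage form attains its maximum 0. Its first variation
  -- there must vanish, and since `A` is invertible this forces `P x = Cᵀ u`.
  have hCP : Cᵀ = -(P * A⁻¹ * B) := by
    rw [← Matrix.toLin'.injective.eq_iff]
    refine LinearMap.ext fun u => ?_
    rw [toLin'_apply, toLin'_apply, neg_mulVec, ← mulVec_mulVec, ← mulVec_mulVec, ← mulVec_neg,
      ← mulVec_neg]
    set x := A⁻¹ *ᵥ -(B *ᵥ u) with hx
    have hAx : A *ᵥ x + B *ᵥ u = 0 := by
      rw [hx, mulVec_mulVec, Matrix.mul_nonsing_inv _ hAdet, one_mulVec,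
        neg_add_cancel]
    have hz : P *ᵥ x - Cᵀ *ᵥ u = 0 := by
      refine dotProduct_eq_zero _ fun v => ?_
      have hv : A *ᵥ (A⁻¹ *ᵥ v) = v := by
        rw [mulVec_mulVec, Matrix.mul_nonsing_inv _ hAdet, one_mulVec]
      refine eq_zero_of_forall_smul_add_sq_nonpos (b := P *ᵥ (A⁻¹ *ᵥ v) ⬝ᵥ v) fun t => ?_
      have h1 := hP (x + t • (A⁻¹ *ᵥ v)) u
      have h2 : A *ᵥ (x + t • (A⁻¹ *ᵥ v)) + B *ᵥ u = t • v := by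
        rw [mulVec_add, mulVec_smul, hv, add_right_comm, hAx, zero_add]
      rw [h2, mulVec_add, mulVec_smul, add_sub_right_comm, add_dotProduct, dotProduct_smul,
        dotProduct_smul, smul_dotProduct, smul_eq_mul, smul_eq_mul, smul_eq_mul] at h1
      linarith
    exact (sub_eq_zero.1 hz).symm
  have hPpos : P.PosDef := by
    have hPpsd : P.PosSemidef :=
      PosSemidef.of_dotProduct_mulVec_nonneg hPs fun x => by simpa using hnonneg x
    refine PosDef.of_dotProduct_mulVec_pos hPs fun {x} hx => ?_
    rw [star_trivial]
    refine (hnonneg x).lt_of_ne' fun h0 => hx ?_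
    have hPx : P *ᵥ x = 0 := (hPpsd.dotProduct_mulVec_zero_iff x).1 (by simpa using h0)
    -- The kernel of `P` is invariant under `A`, and `C` vanishes on it because `C = -Bᵀ A⁻ᵀ P`;
    -- observability then makes it trivial.
    have hstep : ∀ y, P *ᵥ y = 0 → P *ᵥ A *ᵥ y = 0 := fun y hy => by
      refine dotProduct_eq_zero _ fun v => ?_
      rw [dotProduct_comm]
      refine eq_zero_of_forall_smul_add_sq_nonpos (b := v ⬝ᵥ P *ᵥ A *ᵥ v) fun t => ?_
      have h1 := hlyap (y + t • v)
      have h2 : ∀ z, y ⬝ᵥ P *ᵥ z = 0 := fun z => by rw [← hmove, hy, zero_dotProduct]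
      simp only [mulVec_add, mulVec_smul, add_dotProduct, dotProduct_add, h2, smul_dotProduct,
        dotProduct_smul, smul_eq_mul, zero_add] at h1
      linarith
    have hC : C = -(Bᵀ * (A⁻¹)ᵀ * P) := by
      rw [← transpose_transpose C, hCP]
      simp only [transpose_neg, transpose_mul, hPs, Matrix.mul_assoc]
    have hall : ∀ k : ℕ, P *ᵥ A ^ k *ᵥ x = 0 := fun k => by
      induction k with
      | zero => simpa using hPx
      | succ k ih =>
        rw [pow_succ', ← mulVec_mulVec]
        exact hstep _ ih
    refine hobs x fun k => ?_
    rw [hC, neg_mulVec, ← mulVec_mulVec, hall, mulVec_zero, neg_zero]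
  have hPdet : IsUnit P.det := (Matrix.isUnit_iff_isUnit_det P).1 hPpos.isUnit
  have hPis : (P⁻¹)ᵀ = P⁻¹ := by rw [transpose_nonsing_inv, hPs]
  refine ⟨P⁻¹, hPpos.inv, ?_, ?_⟩
  · refine PosSemidef.of_dotProduct_mulVec_nonneg ?_ fun z => ?_
    · rw [IsHermitian, conjTranspose_eq_transpose_of_trivial]
      simp only [transpose_neg, transpose_add, transpose_mul, transpose_transpose, hPis]
      rw [add_comm]
    · rw [star_trivial]
      set y := P⁻¹ *ᵥ z with hy
      have hz : P *ᵥ y = z := by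
        rw [hy, mulVec_mulVec, Matrix.mul_nonsing_inv _ hPdet, one_mulVec]
      have h1 : z ⬝ᵥ (A * P⁻¹) *ᵥ z = y ⬝ᵥ P *ᵥ A *ᵥ y := by
        rw [← mulVec_mulVec, ← hy, ← hmove, hz]
      have h2 : z ⬝ᵥ (P⁻¹ * Aᵀ) *ᵥ z = y ⬝ᵥ P *ᵥ A *ᵥ y := by
        rw [← h1, dotProduct_comm, ← vecMul_transpose, ← dotProduct_mulVec, transpose_mul,
          transpose_transpose, hPis]
      rw [neg_mulVec, dotProduct_neg, add_mulVec, dotProduct_add, h1, h2]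
      linarith [hlyap y]
  · rw [hCP, Matrix.mul_neg, Matrix.mul_assoc P, ← Matrix.mul_assoc (A * P⁻¹) P,
      Matrix.mul_assoc A, Matrix.nonsing_inv_mul _ hPdet, Matrix.mul_one, ← Matrix.mul_assoc,
      Matrix.mul_nonsing_inv _ hAdet, Matrix.one_mul, add_neg_cancel]

end NegImag

/-! ### Values of rational functions and of transfer matrices -/

namespace NegImag

open Matrix Complex Polynomial

/-- The rational function `f` is regular at `z`, with value `v`. -/
def HasValue (f : RatFunc ℂ) (z v : ℂ) : Prop :=
  ∃ p q : ℂ[X], q.eval z ≠ 0 ∧ f * algebraMap ℂ[X] (RatFunc ℂ) q = algebraMap _ _ p ∧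
    v * q.eval z = p.eval z

namespace HasValue

variable {f g : RatFunc ℂ} {z v w : ℂ}

/-- `HasValue` accepts fractions that are not reduced, which makes it stable under sums and
products. This is the passage to lowest terms, where poles and transmission zeros are defined. -/
theorem spec (h : HasValue f z v) :
    f.denom.eval z ≠ 0 ∧ f.num.eval z = v * f.denom.eval z := by
  obtain ⟨p, q, hq, hf, hv⟩ := h
  have hq0 : q ≠ 0 := by rintro rfl; simp at hq
  have hq0' : algebraMap ℂ[X] (RatFunc ℂ) q ≠ 0 := RatFunc.algebraMap_ne_zero hq0
  have hfe : f = algebraMap _ _ p / algebraMap _ _ q := by rw [← hf, mul_div_cancel_right₀ _ hq0']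
  obtain ⟨r, hr⟩ := (RatFunc.denom_dvd hq0).2 ⟨p, hfe⟩
  have h1 := congrArg (eval z) ((RatFunc.num_mul_eq_mul_denom_iff hq0).2 hfe)
  rw [eval_mul, eval_mul, ← hv] at h1
  refine ⟨fun h0 => hq (by rw [hr, eval_mul, h0, zero_mul]), ?_⟩
  apply mul_right_cancel₀ hq
  rw [h1]
  ring

theorem denom_ne_zero (h : HasValue f z v) : f.denom.eval z ≠ 0 := h.spec.1

theorem eval_eq (h : HasValue f z v) : f.eval (RingHom.id ℂ) z = v := by
  rw [RatFunc.eval, eval₂_id, eval₂_id, h.spec.2, mul_div_cancel_right₀ _ h.spec.1]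

theorem num_isRoot_iff (h : HasValue f z v) : f.num.IsRoot z ↔ v = 0 := by
  rw [IsRoot, h.spec.2, mul_eq_zero, or_iff_left h.spec.1]

theorem of_polynomial (p : ℂ[X]) (z : ℂ) :
    HasValue (algebraMap ℂ[X] (RatFunc ℂ) p) z (p.eval z) :=
  ⟨p, 1, by simp, by simp, by simp⟩

theorem add (hf : HasValue f z v) (hg : HasValue g z w) : HasValue (f + g) z (v + w) := by
  obtain ⟨p, q, hq, h, hv⟩ := hf
  obtain ⟨p', q', hq', h', hv'⟩ := hg
  refine ⟨p * q' + p' * q, q * q', by simp [hq, hq'], ?_, ?_⟩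
  · rw [map_mul, map_add, map_mul, map_mul, ← h, ← h']; ring
  · simp only [eval_mul, eval_add, ← hv, ← hv']; ring

theorem mul (hf : HasValue f z v) (hg : HasValue g z w) : HasValue (f * g) z (v * w) := by
  obtain ⟨p, q, hq, h, hv⟩ := hf
  obtain ⟨p', q', hq', h', hv'⟩ := hg
  refine ⟨p * p', q * q', by simp [hq, hq'], ?_, ?_⟩
  · rw [map_mul, map_mul, ← h, ← h']; ring
  · simp only [eval_mul, ← hv, ← hv']; ring

theorem sub (hf : HasValue f z v) (hg : HasValue g z w) : HasValue (f - g) z (v - w) := by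
  have := hf.add ((of_polynomial (-1) z).mul hg)
  simpa [← sub_eq_add_neg] using this

theorem sum {ι : Type*} (s : Finset ι) {f : ι → RatFunc ℂ} {v : ι → ℂ}
    (h : ∀ i ∈ s, HasValue (f i) z (v i)) : HasValue (∑ i ∈ s, f i) z (∑ i ∈ s, v i) := by
  classical
  induction s using Finset.induction_on with
  | empty => simpa using of_polynomial 0 z
  | insert a s ha ih =>
    rw [Finset.sum_insert ha, Finset.sum_insert ha]
    exact (h a (Finset.mem_insert_self a s)).add
      (ih fun i hi => h i (Finset.mem_insert_of_mem hi))

theorem reflect (h : HasValue f (-z) v) :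
    HasValue (f.eval RatFunc.C (-RatFunc.X)) z v := by
  have hcomp : ∀ p : ℂ[X], p.eval₂ RatFunc.C (-RatFunc.X)
      = algebraMap ℂ[X] (RatFunc ℂ) (p.comp (-X)) := fun p => by
    rw [Polynomial.comp, hom_eval₂, map_neg, RatFunc.algebraMap_X]
    congr 1
  have hev : ∀ p : ℂ[X], (p.comp (-X)).eval z = p.eval (-z) := fun p => by simp [eval_comp]
  have hd : f.denom.comp (-X) ≠ 0 := fun h0 => h.denom_ne_zero (by rw [← hev, h0, eval_zero])
  refine ⟨f.num.comp (-X), f.denom.comp (-X), by rw [hev]; exact h.denom_ne_zero, ?_, ?_⟩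
  · rw [RatFunc.eval, hcomp, hcomp, div_mul_cancel₀ _ (RatFunc.algebraMap_ne_zero hd)]
  · rw [hev, hev, h.spec.2]

end HasValue

/-- At a regular point the value of `G u` depends only on `u(z)`, so constant vectors suffice. -/
theorem isTransmissionZero_iff {m : ℕ} {G : Matrix (Fin m) (Fin m) (RatFunc ℂ)} {z : ℂ}
    {V : Matrix (Fin m) (Fin m) ℂ} (h : ∀ i j, HasValue (G i j) z (V i j)) :
    IsTransmissionZero G z ↔ ∃ v ≠ 0, V *ᵥ v = 0 := by
  have key : ∀ (u : Fin m → ℂ[X]) i,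
      HasValue (G.mulVec (fun j => algebraMap ℂ[X] (RatFunc ℂ) (u j)) i) z
        ((V *ᵥ fun j => (u j).eval z) i) := fun u i =>
    HasValue.sum Finset.univ (f := fun j => G i j * algebraMap ℂ[X] (RatFunc ℂ) (u j))
      (v := fun j => V i j * (u j).eval z) fun j _ => (h i j).mul (HasValue.of_polynomial (u j) z)
  constructor
  · rintro ⟨u, ⟨j, hj⟩, hu⟩
    exact ⟨fun j => (u j).eval z, fun h0 => hj (congrFun h0 j),
      funext fun i => ((key u i).num_isRoot_iff).1 (hu i)⟩
  · rintro ⟨v, hv, hV⟩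
    obtain ⟨j, hj⟩ := Function.ne_iff.1 hv
    refine ⟨fun j => C (v j), ⟨j, by simpa using hj⟩, fun i => ((key _ i).num_isRoot_iff).2 ?_⟩
    simp [hV]

theorem evalAt_eq {m : ℕ} {G : Matrix (Fin m) (Fin m) (RatFunc ℂ)} {z : ℂ}
    {V : Matrix (Fin m) (Fin m) ℂ} (h : ∀ i j, HasValue (G i j) z (V i j)) : evalAt G z = V := by
  ext i j
  exact (h i j).eval_eq

variable {n m : ℕ}

/-- The complex matrix `C (z I - A)⁻¹ B + D`. -/
noncomputable def transferValue (A : Matrix (Fin n) (Fin n) ℝ) (B : Matrix (Fin n) (Fin m) ℝ)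
    (C : Matrix (Fin m) (Fin n) ℝ) (D : Matrix (Fin m) (Fin m) ℝ) (z : ℂ) :
    Matrix (Fin m) (Fin m) ℂ :=
  C.map ofReal * (z • 1 - A.map ofReal)⁻¹ * B.map ofReal + D.map ofReal

/-- By Cramer's rule the characteristic polynomial is a common denominator. The polynomial matrix
`N` of numerators is mapped both to rational functions and, by evaluation at `z`, to `ℂ`. -/
theorem hasValue_transferMatrix (A : Matrix (Fin n) (Fin n) ℝ) (B : Matrix (Fin n) (Fin m) ℝ)
    (C : Matrix (Fin m) (Fin n) ℝ) (D : Matrix (Fin m) (Fin m) ℝ) {z : ℂ}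
    (hz : (z • 1 - A.map ofReal).det ≠ 0) (i j : Fin m) :
    HasValue (transferMatrix A B C D i j) z (transferValue A B C D z i j) := by
  set φ : ℂ[X] →+* RatFunc ℂ := algebraMap ℂ[X] (RatFunc ℂ)
  set ε : ℂ[X] →+* ℂ := evalRingHom z
  set S : Matrix (Fin n) (Fin n) ℂ[X] := charmatrix (A.map ofReal) with hS
  have hφS : φ.mapMatrix S
      = Matrix.scalar (Fin n) RatFunc.X - A.map (fun r => RatFunc.C (r : ℂ)) := by
    ext a b
    by_cases h : a = b <;> simp [hS, charmatrix, h, φ, RatFunc.algebraMap_C, RatFunc.algebraMap_X]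
  have hεS : ε.mapMatrix S = z • 1 - A.map ofReal := by
    ext a b
    by_cases h : a = b <;> simp [hS, charmatrix, h, ε]
  have hφC : ∀ {a b : ℕ} (M : Matrix (Fin a) (Fin b) ℝ),
      M.map (fun r => RatFunc.C (r : ℂ)) = (M.map fun r => Polynomial.C (r : ℂ)).map φ := by
    intro a b M; ext i j; simp [φ, RatFunc.algebraMap_C]
  have hεC : ∀ {a b : ℕ} (M : Matrix (Fin a) (Fin b) ℝ),
      M.map ofReal = (M.map fun r => Polynomial.C (r : ℂ)).map ε := by
    intro a b M; ext i j; simp [ε]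
  have hεdet : eval z S.det = (z • 1 - A.map ofReal).det := by
    rw [← hεS, ← RingHom.map_det]; rfl
  have hdet0 : S.det ≠ 0 := by
    intro h0; rw [h0, eval_zero] at hεdet; exact hz hεdet.symm
  have hφdet : φ S.det ≠ 0 := RatFunc.algebraMap_ne_zero hdet0
  have hinvφ : φ S.det • (φ.mapMatrix S)⁻¹ = φ.mapMatrix S.adjugate := by
    rw [Matrix.inv_def, smul_smul, ← RingHom.map_det, Ring.mul_inverse_cancel _ (Ne.isUnit hφdet),
      one_smul, RingHom.map_adjugate]
  have hinvε : ε S.det • (ε.mapMatrix S)⁻¹ = ε.mapMatrix S.adjugate := by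
    have : ε S.det ≠ 0 := hεdet.trans_ne hz
    rw [Matrix.inv_def, smul_smul, ← RingHom.map_det, Ring.mul_inverse_cancel _ (Ne.isUnit this),
      one_smul, RingHom.map_adjugate]
  set N : Matrix (Fin m) (Fin m) ℂ[X] :=
    (C.map fun r => Polynomial.C (r : ℂ)) * S.adjugate * (B.map fun r => Polynomial.C (r : ℂ))
      + S.det • (D.map fun r => Polynomial.C (r : ℂ)) with hN
  have hmapN : ∀ {R : Type} [CommRing R] (ψ : ℂ[X] →+* R),
      N.map ψ = (C.map fun r => Polynomial.C (r : ℂ)).map ψ * ψ.mapMatrix S.adjugate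
        * (B.map fun r => Polynomial.C (r : ℂ)).map ψ
        + ψ S.det • (D.map fun r => Polynomial.C (r : ℂ)).map ψ := by
    intro R _ ψ
    rw [hN, Matrix.map_add ψ (map_add ψ), Matrix.map_mul, Matrix.map_mul,
      Matrix.map_smul' ψ _ _ (map_mul ψ)]
    rfl
  refine ⟨N i j, S.det, hεdet.trans_ne hz, ?_, ?_⟩
  · have h1 : φ S.det • transferMatrix A B C D = N.map φ := by
      rw [hmapN, ← hinvφ, hφS, ← hφC, ← hφC, ← hφC, transferMatrix, smul_add, Matrix.mul_smul,
        Matrix.smul_mul]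
    have h2 := congrFun (congrFun h1 i) j
    rw [Matrix.smul_apply, smul_eq_mul, mul_comm] at h2
    exact h2
  · have h1 : ε S.det • transferValue A B C D z = N.map ε := by
      rw [hmapN, ← hinvε, hεS, ← hεC, ← hεC, ← hεC, transferValue, smul_add, Matrix.mul_smul,
        Matrix.smul_mul]
    have h2 := congrFun (congrFun h1 i) j
    rw [Matrix.smul_apply, smul_eq_mul, mul_comm] at h2
    exact h2

theorem conjTranspose_transferValue (A : Matrix (Fin n) (Fin n) ℝ) (B : Matrix (Fin n) (Fin m) ℝ)
    (C : Matrix (Fin m) (Fin n) ℝ) (D : Matrix (Fin m) (Fin m) ℝ) (z : ℂ) :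
    (transferValue A B C D z)ᴴ = (transferValue A B C D (star z))ᵀ := by
  have hT : ∀ {a b : ℕ} (M : Matrix (Fin a) (Fin b) ℝ), (M.map ofReal)ᴴ = (M.map ofReal)ᵀ := by
    intro a b M; ext i j; simp
  simp only [transferValue, conjTranspose_add, conjTranspose_mul, transpose_add, transpose_mul,
    conjTranspose_nonsing_inv, transpose_nonsing_inv, conjTranspose_sub, transpose_sub,
    conjTranspose_smul, transpose_smul, hT, conjTranspose_one, transpose_one]

/-- On the imaginary axis `-s` is the conjugate of `s`, so for real coefficients `M(-s)ᵀ` becomes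
`M(s)*`. -/
theorem hasValue_sub_reflectTranspose (A : Matrix (Fin n) (Fin n) ℝ)
    (B : Matrix (Fin n) (Fin m) ℝ) (C : Matrix (Fin m) (Fin n) ℝ) (D : Matrix (Fin m) (Fin m) ℝ)
    (hA : IsHurwitz A) (ω : ℝ) (i j : Fin m) :
    HasValue ((transferMatrix A B C D - reflectTranspose (transferMatrix A B C D)) i j) (ω * I)
      ((transferValue A B C D (ω * I) - (transferValue A B C D (ω * I))ᴴ) i j) := by
  have hstar : star ((ω : ℂ) * I) = -(ω * I) := by simp
  rw [conjTranspose_transferValue, hstar]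
  exact (hasValue_transferMatrix A B C D (hA.det_ne_zero (by simp)) i j).sub
    (hasValue_transferMatrix A B C D (hA.det_ne_zero (by simp)) j i).reflect

end NegImag

/-! ### Minimality: controllability, observability and poles -/

namespace NegImag

open Matrix Complex

variable {n m : ℕ}

theorem isUnit_det_scalar_sub {n : Type*} [Fintype n] [DecidableEq n] (A : Matrix n n ℝ) :
    IsUnit (Matrix.scalar n RatFunc.X - A.map (fun r => RatFunc.C (r : ℂ))).det := by
  set φ : Polynomial ℂ →+* RatFunc ℂ := algebraMap (Polynomial ℂ) (RatFunc ℂ)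
  have hφS : φ.mapMatrix (charmatrix (A.map ofReal))
      = Matrix.scalar n RatFunc.X - A.map (fun r => RatFunc.C (r : ℂ)) := by
    ext a b
    by_cases h : a = b <;> simp [charmatrix, h, φ, RatFunc.algebraMap_C, RatFunc.algebraMap_X]
  rw [← hφS, ← RingHom.map_det]
  exact Ne.isUnit (RatFunc.algebraMap_ne_zero (charpoly_monic (A.map ofReal)).ne_zero)

theorem transferMatrix_eq_of_intertwine {k : ℕ} {A : Matrix (Fin n) (Fin n) ℝ}
    {B : Matrix (Fin n) (Fin m) ℝ} {C : Matrix (Fin m) (Fin n) ℝ} {D : Matrix (Fin m) (Fin m) ℝ}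
    {A' : Matrix (Fin k) (Fin k) ℝ} {B' : Matrix (Fin k) (Fin m) ℝ} {C' : Matrix (Fin m) (Fin k) ℝ}
    (T : Matrix (Fin n) (Fin k) ℝ) (hA : A * T = T * A') (hB : B = T * B') (hC : C' = C * T) :
    transferMatrix A' B' C' D = transferMatrix A B C D := by
  have hmul : ∀ {a b c : ℕ} (M : Matrix (Fin a) (Fin b) ℝ) (M' : Matrix (Fin b) (Fin c) ℝ),
      (M * M').map (fun r => RatFunc.C (r : ℂ))
        = M.map (fun r => RatFunc.C (r : ℂ)) * M'.map (fun r => RatFunc.C (r : ℂ)) :=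
    fun M M' => Matrix.map_mul (f := (RatFunc.C (K := ℂ)).comp Complex.ofRealHom)
  have hS := isUnit_det_scalar_sub A
  have hS' := isUnit_det_scalar_sub A'
  rw [transferMatrix, transferMatrix, hB, hC]
  simp only [hmul]
  have hAT := congrArg (fun M => M.map (fun r => RatFunc.C (r : ℂ))) hA
  simp only [hmul] at hAT
  set Tι := T.map (fun r => RatFunc.C (r : ℂ))
  set S := Matrix.scalar (Fin n) RatFunc.X - A.map (fun r => RatFunc.C (r : ℂ)) with hSdef
  set S' := Matrix.scalar (Fin k) RatFunc.X - A'.map (fun r => RatFunc.C (r : ℂ)) with hS'def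
  have hST : S * Tι = Tι * S' := by
    rw [hSdef, hS'def, Matrix.sub_mul, Matrix.mul_sub, hAT]
    congr 1
    ext a b
    simp [mul_comm]
  have hinv : Tι * S'⁻¹ = S⁻¹ * Tι := by
    calc Tι * S'⁻¹ = S⁻¹ * (S * Tι) * S'⁻¹ := by
          rw [← Matrix.mul_assoc, Matrix.nonsing_inv_mul _ hS, Matrix.one_mul]
      _ = S⁻¹ * Tι := by
          rw [hST, Matrix.mul_assoc, Matrix.mul_assoc, Matrix.mul_nonsing_inv _ hS',
            Matrix.mul_one]
  rw [Matrix.mul_assoc _ Tι, hinv]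
  simp only [Matrix.mul_assoc]

/-- The vectors `A ^ k b`, with `b` a column of `B`, span the state space. -/
def IsControllable (A : Matrix (Fin n) (Fin n) ℝ) (B : Matrix (Fin n) (Fin m) ℝ) : Prop :=
  Submodule.span ℝ (Set.range fun p : ℕ × Fin m => A ^ p.1 *ᵥ B.col p.2) = ⊤

/-- The reachable subspace `R` is invariant under `A` and contains the range of `B`. Restricting the
system to it keeps the transfer matrix with `dim R` states, so `R` is everything. -/
theorem IsMinimal.isControllable {A : Matrix (Fin n) (Fin n) ℝ} {B : Matrix (Fin n) (Fin m) ℝ}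
    {C : Matrix (Fin m) (Fin n) ℝ} {D : Matrix (Fin m) (Fin m) ℝ} (h : IsMinimal A B C D) :
    IsControllable A B := by
  set R := Submodule.span ℝ (Set.range fun p : ℕ × Fin m => A ^ p.1 *ᵥ B.col p.2) with hR
  have hRA : ∀ x ∈ R, A.mulVecLin x ∈ R := by
    suffices R ≤ R.comap A.mulVecLin from this
    rw [hR, Submodule.span_le]
    rintro _ ⟨⟨k, j⟩, rfl⟩
    refine Submodule.subset_span ⟨(k + 1, j), ?_⟩
    simp [pow_succ']
  have hRB : ∀ u, B.mulVecLin u ∈ R := fun u => by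
    rw [mulVecLin_apply, mulVec_eq_sum]
    refine Submodule.sum_mem _ fun j _ => ?_
    rw [op_smul_eq_smul]
    refine Submodule.smul_mem _ _ (Submodule.subset_span ⟨(0, j), ?_⟩)
    simp [Matrix.col]
  set b := Module.finBasis ℝ R
  set e := Pi.basisFun ℝ (Fin n)
  set e' := Pi.basisFun ℝ (Fin m)
  set T := LinearMap.toMatrix b e R.subtype with hT
  set A' := LinearMap.toMatrix b b (A.mulVecLin.restrict hRA) with hA'
  set B' := LinearMap.toMatrix e' b (B.mulVecLin.codRestrict R hRB) with hB'
  have hAe : LinearMap.toMatrix e e A.mulVecLin = A := by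
    rw [LinearMap.toMatrix_eq_toMatrix']; exact LinearMap.toMatrix'_toLin' A
  have hBe : LinearMap.toMatrix e' e B.mulVecLin = B := by
    ext i j
    simp [LinearMap.toMatrix_apply, e, e']
  have hle := h _ A' B' (C * T) D (transferMatrix_eq_of_intertwine T
    (by
      conv_lhs => rw [← hAe]
      rw [hT, hA', ← LinearMap.toMatrix_comp, ← LinearMap.toMatrix_comp]
      rfl)
    (by
      conv_lhs => rw [← hBe]
      rw [hT, hB', ← LinearMap.toMatrix_comp]
      rfl) rfl)
  refine Submodule.eq_top_of_finrank_eq (le_antisymm (Submodule.finrank_le _) ?_)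
  simpa using hle

theorem transferMatrix_transpose (A : Matrix (Fin n) (Fin n) ℝ) (B : Matrix (Fin n) (Fin m) ℝ)
    (C : Matrix (Fin m) (Fin n) ℝ) (D : Matrix (Fin m) (Fin m) ℝ) :
    transferMatrix Aᵀ Cᵀ Bᵀ Dᵀ = (transferMatrix A B C D)ᵀ := by
  simp only [transferMatrix, transpose_add, transpose_mul, transpose_map, transpose_nonsing_inv,
    transpose_sub, Matrix.mul_assoc]
  simp

theorem IsMinimal.transpose {A : Matrix (Fin n) (Fin n) ℝ} {B : Matrix (Fin n) (Fin m) ℝ}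
    {C : Matrix (Fin m) (Fin n) ℝ} {D : Matrix (Fin m) (Fin m) ℝ} (h : IsMinimal A B C D) :
    IsMinimal Aᵀ Cᵀ Bᵀ Dᵀ := fun k A' B' C' D' h' => by
  refine h k A'ᵀ C'ᵀ B'ᵀ D'ᵀ ?_
  rw [transferMatrix_transpose, h', transferMatrix_transpose, transpose_transpose]

theorem IsControllable.eq_zero {A : Matrix (Fin n) (Fin n) ℝ} {B : Matrix (Fin n) (Fin m) ℝ}
    (h : IsControllable A B) {l : ℕ} (Q : Matrix (Fin l) (Fin n) ℝ)
    (hQ : ∀ k : ℕ, Q * (A ^ k * B) = 0) : Q = 0 := by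
  have hle : Submodule.span ℝ (Set.range fun p : ℕ × Fin m => A ^ p.1 *ᵥ B.col p.2)
      ≤ LinearMap.ker Q.mulVecLin := by
    rw [Submodule.span_le]
    rintro _ ⟨⟨k, j⟩, rfl⟩
    simp only [SetLike.mem_coe, LinearMap.mem_ker, mulVecLin_apply]
    rw [← mulVec_single_one B j, mulVec_mulVec, mulVec_mulVec, Matrix.mul_assoc, hQ, zero_mulVec]
  rw [h, top_le_iff, LinearMap.ker_eq_top] at hle
  exact Matrix.toLin'.injective (hle.trans (map_zero Matrix.toLin').symm)

theorem IsControllable.eq_zero_of_observable {A : Matrix (Fin n) (Fin n) ℝ}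
    {C : Matrix (Fin m) (Fin n) ℝ} (h : IsControllable Aᵀ Cᵀ) (x : Fin n → ℝ)
    (hx : ∀ k : ℕ, C *ᵥ A ^ k *ᵥ x = 0) : x = 0 := by
  have := h.eq_zero (of fun _ : Fin 1 => x) fun k => by
    rw [← transpose_pow, ← transpose_mul]
    ext i j
    have := congrFun (hx k) j
    rw [mulVec_mulVec] at this
    exact (dotProduct_comm x ((C * A ^ k) j)).trans this
  exact congrFun this 0

section

open Filter Topology Asymptotics

/-- The function `s ↦ wᵀ (s I - A)⁻¹ y`. -/
noncomputable def resolventForm (A : Matrix (Fin n) (Fin n) ℝ) (w y : Fin n → ℝ) (s : ℂ) : ℂ :=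
  (ofReal ∘ w) ⬝ᵥ (s • 1 - A.map ofReal)⁻¹ *ᵥ (ofReal ∘ y)

theorem eventually_det_ne_zero (A : Matrix (Fin n) (Fin n) ℝ) (z : ℂ) :
    ∀ᶠ s in 𝓝[≠] z, (s • 1 - A.map ofReal).det ≠ 0 := by
  have h0 : (A.map ofReal).charpoly ≠ 0 := (charpoly_monic _).ne_zero
  have hfin : ((A.map ofReal).charpoly.roots.toFinset : Set ℂ).Finite := Finset.finite_toSet _
  have h := (hfin.subset (Set.sdiff_subset (t := {z}))).isClosed.isOpen_compl.mem_nhds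
    (show z ∈ _ from fun hz => hz.2 rfl)
  filter_upwards [nhdsWithin_le_nhds h, self_mem_nhdsWithin] with s hs hsz hdet
  refine hs ⟨?_, hsz⟩
  simp only [Finset.mem_coe, Multiset.mem_toFinset, Polynomial.mem_roots h0, Polynomial.IsRoot]
  rwa [eval_charpoly, scalar_apply, ← smul_one_eq_diagonal]

theorem resolventForm_mulVec (A : Matrix (Fin n) (Fin n) ℝ) (w y : Fin n → ℝ) {s : ℂ}
    (hs : (s • 1 - A.map ofReal).det ≠ 0) :
    resolventForm A w (A *ᵥ y) s = s * resolventForm A w y s - ((w ⬝ᵥ y : ℝ) : ℂ) := by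
  have hmap : ofReal ∘ (A *ᵥ y) = A.map ofReal *ᵥ (ofReal ∘ y) := by
    ext i; simp [mulVec, dotProduct]
  have hdot : ((w ⬝ᵥ y : ℝ) : ℂ) = (ofReal ∘ w) ⬝ᵥ (ofReal ∘ y) := by simp [dotProduct]
  have hinv := Matrix.nonsing_inv_mul _ (Ne.isUnit hs)
  rw [Matrix.mul_sub, Matrix.mul_smul, Matrix.mul_one] at hinv
  rw [sub_eq_iff_eq_add, ← sub_eq_iff_eq_add'] at hinv
  rw [resolventForm, resolventForm, hmap, mulVec_mulVec, ← hinv, hdot, sub_mulVec, smul_mulVec,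
    one_mulVec, dotProduct_sub, dotProduct_smul, smul_eq_mul]

theorem resolventForm_transpose (A : Matrix (Fin n) (Fin n) ℝ) (w y : Fin n → ℝ) (s : ℂ) :
    resolventForm Aᵀ w y s = resolventForm A y w s := by
  have : s • 1 - Aᵀ.map ofReal = (s • 1 - A.map ofReal)ᵀ := by
    simp [transpose_map]
  rw [resolventForm, resolventForm, this, ← transpose_nonsing_inv, mulVec_transpose,
    dotProduct_comm, ← dotProduct_mulVec]

/-- The vectors `y` whose resolvent form stays bounded near `z` form a subspace, and
`resolventForm_mulVec` makes it invariant under `A`. -/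
theorem isBigO_resolventForm_of_controllable {l : ℕ} {A : Matrix (Fin n) (Fin n) ℝ}
    {B : Matrix (Fin n) (Fin l) ℝ} (hctrl : IsControllable A B) (w : Fin n → ℝ) (z : ℂ)
    (h : ∀ j, resolventForm A w (B.col j) =O[𝓝[≠] z] fun _ => (1 : ℝ)) (y : Fin n → ℝ) :
    resolventForm A w y =O[𝓝[≠] z] fun _ => (1 : ℝ) := by
  have hmem : y ∈ Submodule.span ℝ (Set.range fun p : ℕ × Fin l => A ^ p.1 *ᵥ B.col p.2) := by
    rw [hctrl]; trivial
  induction hmem using Submodule.span_induction with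
  | mem x hx =>
    obtain ⟨⟨k, j⟩, rfl⟩ := hx
    dsimp only
    induction k with
    | zero => simpa using h j
    | succ k ih =>
      rw [pow_succ', ← mulVec_mulVec]
      have hs : (fun s : ℂ => s) =O[𝓝[≠] z] fun _ => (1 : ℝ) :=
        (tendsto_id.mono_left nhdsWithin_le_nhds).isBigO_one ℝ
      have h1 := (hs.mul ih).sub (isBigO_const_const
        (((w ⬝ᵥ A ^ k *ᵥ B.col j : ℝ) : ℂ)) (one_ne_zero (α := ℝ)) (𝓝[≠] z) |>.trans
          (isBigO_refl _ _ |>.congr_right fun _ => (mul_one (1 : ℝ)).symm))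
      simp only [mul_one] at h1
      refine h1.congr' ?_ EventuallyEq.rfl
      filter_upwards [eventually_det_ne_zero A z] with s hs
      exact (resolventForm_mulVec A w _ hs).symm
  | zero =>
    have : resolventForm A w 0 = fun _ => 0 := by
      ext s
      have : (ofReal ∘ (0 : Fin n → ℝ)) = 0 := by ext; simp
      rw [resolventForm, this, mulVec_zero, dotProduct_zero]
    rw [this]
    exact isBigO_zero _ _
  | add x y _ _ hx hy =>
    refine (hx.add hy).congr_left fun s => ?_
    have : (ofReal ∘ (x + y)) = ofReal ∘ x + ofReal ∘ y := by ext; simp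
    rw [resolventForm, resolventForm, resolventForm, this, mulVec_add, dotProduct_add]
  | smul c x _ hx =>
    refine (hx.const_mul_left (c : ℂ)).congr_left fun s => ?_
    have : (ofReal ∘ (c • x)) = (c : ℂ) • (ofReal ∘ x) := by ext; simp
    rw [resolventForm, resolventForm, this, mulVec_smul, dotProduct_smul, smul_eq_mul]

/-- Every eigenvalue of the system matrix of a minimal system is a pole of the transfer matrix. -/
theorem IsMinimal.isPole_of_eigenvalue {A : Matrix (Fin n) (Fin n) ℝ}
    {B : Matrix (Fin n) (Fin m) ℝ} {C : Matrix (Fin m) (Fin n) ℝ} {D : Matrix (Fin m) (Fin m) ℝ}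
    (h : IsMinimal A B C D) {z : ℂ} {v : Fin n → ℂ} (hv : v ≠ 0)
    (hz : A.map ofReal *ᵥ v = z • v) : IsPole (transferMatrix A B C D) z := by
  by_contra hpole
  simp only [IsPole, not_exists, Polynomial.IsRoot] at hpole
  have hentry : ∀ i j, resolventForm A (C.row i) (B.col j) =O[𝓝[≠] z] fun _ => (1 : ℝ) := by
    intro i j
    set f := transferMatrix A B C D i j
    have hcont : ContinuousAt (fun s => f.num.eval s / f.denom.eval s - (D i j : ℂ)) z :=
      (f.num.continuous.continuousAt.div f.denom.continuous.continuousAt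
        (hpole i j)).sub continuousAt_const
    refine ((hcont.tendsto.mono_left nhdsWithin_le_nhds).isBigO_one ℝ).congr' ?_ EventuallyEq.rfl
    filter_upwards [eventually_det_ne_zero A z] with s hs
    have h1 := (hasValue_transferMatrix A B C D hs i j).eval_eq
    rw [RatFunc.eval, Polynomial.eval₂_id, Polynomial.eval₂_id] at h1
    rw [h1, transferValue, Matrix.add_apply, map_apply, add_sub_cancel_right, resolventForm,
      Matrix.mul_assoc]
    simp only [Matrix.mul_apply, mulVec, dotProduct]
    rfl
  -- Without a pole at `z`, controllability frees the right vector and, in the transposed system,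
  -- the left one. The whole resolvent is then bounded near `z`, whereas `(s - z)(sI - A)⁻¹ v = v`
  -- for the eigenvector `v`.
  have hrow : ∀ i y, resolventForm A (C.row i) y =O[𝓝[≠] z] fun _ => (1 : ℝ) := fun i =>
    isBigO_resolventForm_of_controllable h.isControllable _ z (hentry i)
  have hall : ∀ w y, resolventForm A w y =O[𝓝[≠] z] fun _ => (1 : ℝ) := fun w y => by
    have := isBigO_resolventForm_of_controllable h.transpose.isControllable y z (fun i => by
      refine (hrow i y).congr_left fun s => ?_
      rw [resolventForm_transpose]
      rfl) w
    exact this.congr_left fun s => resolventForm_transpose A y w s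
  obtain ⟨i, hi⟩ := Function.ne_iff.1 hv
  have hsum : (fun s : ℂ => ∑ j, resolventForm A (Pi.single i 1) (Pi.single j 1) s * v j)
      =O[𝓝[≠] z] fun _ => (1 : ℝ) := by
    refine IsBigO.fun_sum fun j _ => ?_
    simpa [mul_comm] using (hall (Pi.single i 1) (Pi.single j 1)).const_mul_left (v j)
  have hlim : (fun s : ℂ => s - z) =o[𝓝[≠] z] fun _ => (1 : ℝ) := by
    rw [isLittleO_one_iff]
    have : Tendsto (fun s : ℂ => s - z) (𝓝 z) (𝓝 (z - z)) :=
      (continuous_id.sub continuous_const).tendsto z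
    rw [sub_self] at this
    exact this.mono_left nhdsWithin_le_nhds
  have hprod := hlim.mul_isBigO hsum
  simp only [mul_one, isLittleO_one_iff] at hprod
  refine hi (tendsto_nhds_unique (tendsto_const_nhds.congr' ?_) hprod)
  filter_upwards [eventually_det_ne_zero A z] with s hs
  have hsv : (s • 1 - A.map ofReal) *ᵥ v = (s - z) • v := by
    rw [sub_mulVec, smul_mulVec, one_mulVec, hz, sub_smul]
  have h1 : (s - z) • ((s • 1 - A.map ofReal)⁻¹ *ᵥ v) = v := by
    rw [← mulVec_smul, ← hsv, mulVec_mulVec, Matrix.nonsing_inv_mul _ (Ne.isUnit hs), one_mulVec]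
  have hsingle : ∀ j : Fin n, (ofReal ∘ (Pi.single j 1 : Fin n → ℝ)) = Pi.single j (1 : ℂ) := by
    intro j; ext a; by_cases h : a = j <;> simp [h]
  have h2 : ∑ j, resolventForm A (Pi.single i 1) (Pi.single j 1) s * v j
      = ((s • 1 - A.map ofReal)⁻¹ *ᵥ v) i := by
    simp only [resolventForm, hsingle, mulVec_single_one, single_one_dotProduct]
    rfl
  rw [h2]
  exact (congrFun h1 i).symm

end

end NegImag

/-! ### Stability and the factorized imaginary part -/

namespace NegImag

open Matrix Complex

variable {n m : ℕ}

section

open Filter Topology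

attribute [local instance] Matrix.linftyOpNormedRing Matrix.linftyOpNormedAlgebra

theorem tendsto_resolvent_imaginary_axis (A : Matrix (Fin n) (Fin n) ℂ) :
    Tendsto (fun ω : ℝ => (((ω : ℂ) * I) • 1 - A)⁻¹) atTop (𝓝 0) := by
  have h1 : Tendsto (fun ω : ℝ => (ω : ℂ) * I) atTop (Bornology.cobounded ℂ) := by
    rw [← tendsto_norm_atTop_iff_cobounded]
    simpa using tendsto_abs_atTop_atTop
  have h2 := (spectrum.resolvent_tendsto_cobounded (𝕜 := ℂ) A).comp h1
  refine h2.congr fun ω => ?_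
  rw [Function.comp_apply, resolvent, Matrix.nonsing_inv_eq_ringInverse,
    Algebra.algebraMap_eq_smul_one]

end

theorem IsHurwitz.not_hasEigenvalue {A : Matrix (Fin n) (Fin n) ℝ} (hA : IsHurwitz A) (ω : ℝ) :
    ¬ Module.End.HasEigenvalue (Matrix.toLin' (A.map ofReal)) ((ω : ℂ) * I) := fun h => by
  obtain ⟨v, hv⟩ := h.exists_hasEigenvector
  have := hA _ v hv.2 (by simpa using hv.apply_eq_smul)
  simp at this

theorem IsHurwitz.re_neg_of_isPole {A : Matrix (Fin n) (Fin n) ℝ} (hA : IsHurwitz A)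
    {B : Matrix (Fin n) (Fin m) ℝ} {C : Matrix (Fin m) (Fin n) ℝ} {D : Matrix (Fin m) (Fin m) ℝ}
    {z : ℂ} (hz : IsPole (transferMatrix A B C D) z) : z.re < 0 := by
  by_contra! h
  obtain ⟨i, j, hij⟩ := hz
  exact (hasValue_transferMatrix A B C D (hA.det_ne_zero h) i j).denom_ne_zero hij

theorem IsHurwitz.evalAt_transferMatrix {A : Matrix (Fin n) (Fin n) ℝ} (hA : IsHurwitz A)
    (B : Matrix (Fin n) (Fin m) ℝ) (C : Matrix (Fin m) (Fin n) ℝ) (D : Matrix (Fin m) (Fin m) ℝ)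
    (ω : ℝ) : evalAt (transferMatrix A B C D) (ω * I) = transferValue A B C D (ω * I) :=
  evalAt_eq fun i j => hasValue_transferMatrix A B C D (hA.det_ne_zero (by simp)) i j

/-- A system matrix without imaginary eigenvalues is Hurwitz if it satisfies a Lyapunov
inequality. -/
theorem isHurwitz_of_lyapunov {A Y : Matrix (Fin n) (Fin n) ℝ}
    (hA : ∀ ω : ℝ, ¬ Module.End.HasEigenvalue (Matrix.toLin' (A.map ofReal)) ((ω : ℂ) * I))
    (hY : Y.PosDef) (hAY : (-(A * Y + Y * Aᵀ)).PosSemidef) : IsHurwitz A := by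
  intro z v hv hz
  have hY' : (Y.map ofReal).PosDef := by
    refine (posSemidef_map_ofReal hY.posSemidef).posDef_iff_isUnit.2 ?_
    rw [Matrix.isUnit_iff_isUnit_det, det_map_ofReal]
    exact ((Matrix.isUnit_iff_isUnit_det Y).1 hY.isUnit).map Complex.ofRealHom
  have hdet : (z • 1 - A.map ofReal).det = 0 := exists_mulVec_eq_zero_iff.1
    ⟨v, hv, by rw [sub_mulVec, smul_mulVec, one_mulVec, hz, sub_self]⟩
  -- For a left eigenvector `u*`, the value `u*(AY + YAᵀ)u` is `2 Re z` times `u*Yu > 0`, so `Re z ≤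
  -- 0`; the hypothesis on the axis excludes equality.
  obtain ⟨w, hw, hw'⟩ := exists_vecMul_eq_zero_iff.2 hdet
  obtain ⟨u, rfl⟩ : ∃ u, w = star u := ⟨star w, (star_star w).symm⟩
  have hu : u ≠ 0 := fun h => hw (by rw [h, star_zero])
  have hl : star u ᵥ* A.map ofReal = z • star u := by
    rw [vecMul_sub, vecMul_smul, vecMul_one, sub_eq_zero] at hw'
    exact hw'.symm
  have hr : (Aᵀ).map ofReal *ᵥ u = star z • u := by
    have := congrArg star hl
    rwa [star_vecMul, star_star, conjTranspose_map_ofReal, star_smul, star_star] at this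
  have h1 := hY'.dotProduct_mulVec_pos hu
  have h2 := (posSemidef_map_ofReal hAY).dotProduct_mulVec_nonneg u
  have hmap : (-(A * Y + Y * Aᵀ)).map ofReal
      = -(A.map ofReal * Y.map ofReal + Y.map ofReal * (Aᵀ).map ofReal) := by
    rw [← map_ofReal_mul, ← map_ofReal_mul, ← map_ofReal_add]
    ext i j; simp
  rw [hmap, neg_mulVec, add_mulVec, dotProduct_neg, dotProduct_add, ← mulVec_mulVec,
    ← mulVec_mulVec, hr, dotProduct_mulVec, hl, mulVec_smul, dotProduct_smul, smul_dotProduct,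
    smul_eq_mul, smul_eq_mul, ← add_mul] at h2
  set r := star u ⬝ᵥ Y.map ofReal *ᵥ u
  have hr0 := (Complex.pos_iff.1 h1).1
  have h3 : 0 ≤ -(2 * z.re * r.re) := by
    have hzz : z + star z = ((2 * z.re : ℝ) : ℂ) := Complex.add_conj z
    rw [hzz] at h2
    have := (Complex.nonneg_iff.1 h2).1
    rwa [neg_re, re_ofReal_mul] at this
  rcases lt_or_eq_of_le (show z.re ≤ 0 by nlinarith) with h | h
  · exact h
  · refine absurd (Module.End.hasEigenvalue_of_hasEigenvector (x := v) ?_) (hA z.im)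
    rw [Module.End.hasEigenvector_iff, Module.End.mem_eigenspace_iff]
    refine ⟨?_, hv⟩
    rw [toLin'_apply, hz]
    congr 1
    apply Complex.ext <;> simp [h]

/-- Substituting `B = -AYCᵀ` and `RA = zR - 1` gives `M = D + CYCᵀ - z CRYCᵀ`, whose constant part
is Hermitian and cancels. The rest is recombined through `SY + YS* = -(AY + YAᵀ)`, where `S = zI -
A`. -/
theorem imaginary_part_factorization {A Y : Matrix (Fin n) (Fin n) ℝ}
    {B : Matrix (Fin n) (Fin m) ℝ} {C : Matrix (Fin m) (Fin n) ℝ} {D : Matrix (Fin m) (Fin m) ℝ}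
    (hA : IsHurwitz A) (hD : D.IsSymm) (hY : Yᵀ = Y) (hB : B + A * Y * Cᵀ = 0) (ω : ℝ) :
    I • (transferValue A B C D (ω * I) - (transferValue A B C D (ω * I))ᴴ)
      = (ω : ℂ) • (C.map ofReal * (((ω : ℂ) * I) • 1 - A.map ofReal)⁻¹
          * (-(A * Y + Y * Aᵀ)).map ofReal
          * (C.map ofReal * (((ω : ℂ) * I) • 1 - A.map ofReal)⁻¹)ᴴ) := by
  set z : ℂ := (ω : ℂ) * I with hz
  have hzs : star z = -z := by simp [hz]
  set a := A.map ofReal with ha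
  set c := C.map ofReal with hc
  set y := Y.map ofReal with hy
  set d := D.map ofReal with hd
  set S := z • 1 - a with hS
  have hSu : IsUnit S.det := Ne.isUnit (hA.det_ne_zero (by simp [hz]))
  set R := S⁻¹ with hR
  have hyH : yᴴ = y := by rw [hy, conjTranspose_map_ofReal, hY]
  have hdH : dᴴ = d := by rw [hd, conjTranspose_map_ofReal, hD]
  have hb : B.map ofReal = -(a * y * cᴴ) := by
    rw [eq_neg_of_add_eq_zero_left hB, hc, conjTranspose_map_ofReal, ← map_ofReal_mul,
      ← map_ofReal_mul]
    ext i j; simp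
  have hq : (-(A * Y + Y * Aᵀ)).map ofReal = S * y + y * Sᴴ := by
    have h1 : (-(A * Y + Y * Aᵀ)).map ofReal = -(a * y + y * aᴴ) := by
      rw [ha, conjTranspose_map_ofReal, ← map_ofReal_mul, ← map_ofReal_mul, ← map_ofReal_add]
      ext i j; simp
    rw [h1, hS, conjTranspose_sub, conjTranspose_smul, conjTranspose_one, hzs]
    simp only [Matrix.sub_mul, Matrix.mul_sub, Matrix.smul_mul, Matrix.mul_smul, Matrix.one_mul,
      Matrix.mul_one, neg_smul, Matrix.mul_neg]
    abel
  have hRS : R * S = 1 := Matrix.nonsing_inv_mul _ hSu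
  have hSR : Sᴴ * Rᴴ = 1 := by rw [← conjTranspose_mul, hRS, conjTranspose_one]
  have hRa : R * a = z • R - 1 := by
    rw [← hRS, hS, Matrix.mul_sub, Matrix.mul_smul, Matrix.mul_one, sub_sub_cancel]
  have hV : transferValue A B C D z = d + c * y * cᴴ - z • (c * R * y * cᴴ) := by
    rw [transferValue, hb, ← hS, ← hR]
    have : c * R * -(a * y * cᴴ) = -(c * (R * a) * y * cᴴ) := by
      simp only [Matrix.mul_neg, Matrix.mul_assoc]
    rw [this, hRa, Matrix.mul_sub, Matrix.sub_mul, Matrix.sub_mul, Matrix.mul_one,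
      Matrix.mul_smul, Matrix.smul_mul, Matrix.smul_mul]
    abel
  have hVH : (transferValue A B C D z)ᴴ = d + c * y * cᴴ + z • (c * y * Rᴴ * cᴴ) := by
    rw [hV]
    simp only [conjTranspose_sub, conjTranspose_add, conjTranspose_mul, conjTranspose_smul,
      conjTranspose_conjTranspose, hyH, hdH, hzs, Matrix.mul_assoc, neg_smul, sub_neg_eq_add]
  have hRHS : c * R * (S * y + y * Sᴴ) * (c * R)ᴴ = c * y * Rᴴ * cᴴ + c * R * y * cᴴ := by
    rw [Matrix.mul_add, Matrix.add_mul, conjTranspose_mul]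
    congr 1
    · calc _ = c * (R * S) * y * Rᴴ * cᴴ := by simp only [Matrix.mul_assoc]
        _ = _ := by rw [hRS, Matrix.mul_one]
    · calc _ = c * R * y * (Sᴴ * Rᴴ) * cᴴ := by simp only [Matrix.mul_assoc]
        _ = _ := by rw [hSR, Matrix.mul_one]
  rw [hq, hRHS, hVH, hV]
  have hIz : (ω : ℂ) = -(I * z) := by rw [hz]; linear_combination (ω : ℂ) * I_mul_I
  have hsub : d + c * y * cᴴ - z • (c * R * y * cᴴ) - (d + c * y * cᴴ + z • (c * y * Rᴴ * cᴴ))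
      = -(z • (c * y * Rᴴ * cᴴ + c * R * y * cᴴ)) := by
    rw [smul_add]
    abel
  rw [hsub, hIz, smul_neg, smul_smul, neg_smul]

end NegImag

/-! ### Frequency inequalities from the SNI property -/

namespace NegImag

open Matrix Complex

variable {n m : ℕ}

open Filter Topology in
theorem tendsto_transferValue (A : Matrix (Fin n) (Fin n) ℝ) (B : Matrix (Fin n) (Fin m) ℝ)
    (C : Matrix (Fin m) (Fin n) ℝ) (D : Matrix (Fin m) (Fin m) ℝ) :
    Tendsto (fun ω : ℝ => transferValue A B C D (ω * I)) atTop (𝓝 (D.map ofReal)) := by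
  have hcont : Continuous fun R : Matrix (Fin n) (Fin n) ℂ =>
      C.map ofReal * R * B.map ofReal + D.map ofReal := by fun_prop
  have := (hcont.tendsto 0).comp (tendsto_resolvent_imaginary_axis (A.map ofReal))
  simpa using! this

/-- The feedthrough matrix of a strictly negative-imaginary system is symmetric. -/
theorem isSymm_of_posDef {A : Matrix (Fin n) (Fin n) ℝ} {B : Matrix (Fin n) (Fin m) ℝ}
    {C : Matrix (Fin m) (Fin n) ℝ} {D : Matrix (Fin m) (Fin m) ℝ}
    (h : ∀ ω : ℝ, 0 < ω →
      (I • (transferValue A B C D (ω * I) - (transferValue A B C D (ω * I))ᴴ)).PosDef) :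
    D.IsSymm := by
  set N := I • (D.map ofReal - (D.map ofReal)ᴴ) with hN
  have hpsd : N.PosSemidef := by
    refine PosSemidef.of_dotProduct_mulVec_nonneg ?_ fun x => ?_
    · rw [IsHermitian, hN, conjTranspose_smul, conjTranspose_sub, conjTranspose_conjTranspose,
        star_def, conj_I, neg_smul, ← smul_neg, neg_sub]
    · have hcont : Continuous fun M : Matrix (Fin m) (Fin m) ℂ =>
          star x ⬝ᵥ (I • (M - Mᴴ)) *ᵥ x := by fun_prop
      refine ge_of_tendsto ((hcont.tendsto _).comp (tendsto_transferValue A B C D)) ?_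
      filter_upwards [Filter.eventually_gt_atTop 0] with ω hω
      exact (h ω hω).posSemidef.dotProduct_mulVec_nonneg x
  -- `N` is positive semidefinite as a limit at infinite frequency. Antisymmetry makes its trace
  -- zero, hence `N = 0`.
  have htr : Nᵀ = -N := by
    ext i j; simp [hN]; ring
  have h0 : N.trace = 0 := by
    have := trace_transpose N
    rw [htr, trace_neg] at this
    linear_combination (-1 / 2 : ℂ) * this
  have hN0 := hpsd.trace_eq_zero_iff.1 h0
  rw [IsSymm]
  ext i j
  have := congrFun (congrFun hN0 i) j
  simp only [hN, Matrix.smul_apply, Matrix.sub_apply, map_apply, conjTranspose_apply, smul_eq_mul,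
    mul_eq_zero, I_ne_zero, false_or, Matrix.zero_apply, sub_eq_zero] at this
  simpa using this.symm

/-- The frequency domain inequality for `s C (s I - A)⁻¹ B`. -/
theorem re_freq_nonneg {A : Matrix (Fin n) (Fin n) ℝ} {B : Matrix (Fin n) (Fin m) ℝ}
    {C : Matrix (Fin m) (Fin n) ℝ} {D : Matrix (Fin m) (Fin m) ℝ} (hD : D.IsSymm) {ω : ℝ}
    (hω : 0 < ω)
    (h : (I • (transferValue A B C D (ω * I) - (transferValue A B C D (ω * I))ᴴ)).PosDef)
    (u : Fin m → ℂ) :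
    0 ≤ (I * ω * (star u ⬝ᵥ C.map ofReal *ᵥ
      (((ω : ℂ) * I) • 1 - A.map ofReal)⁻¹ *ᵥ B.map ofReal *ᵥ u)).re := by
  set X := C.map ofReal * (((ω : ℂ) * I) • 1 - A.map ofReal)⁻¹ * B.map ofReal with hX
  have hdH : (D.map ofReal)ᴴ = D.map ofReal := by rw [conjTranspose_map_ofReal, hD]
  have hV : transferValue A B C D (ω * I) - (transferValue A B C D (ω * I))ᴴ = X - Xᴴ := by
    rw [transferValue, ← hX, conjTranspose_add, hdH, add_sub_add_right_eq_sub]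
  rw [hV] at h
  have h1 := (Complex.nonneg_iff.1 (h.posSemidef.dotProduct_mulVec_nonneg u)).1
  have hXu : C.map ofReal *ᵥ (((ω : ℂ) * I) • 1 - A.map ofReal)⁻¹ *ᵥ B.map ofReal *ᵥ u
      = X *ᵥ u := by rw [hX, ← mulVec_mulVec, ← mulVec_mulVec]
  have hXH : star u ⬝ᵥ Xᴴ *ᵥ u = star (star u ⬝ᵥ X *ᵥ u) := by
    rw [← star_dotProduct, star_mulVec, ← dotProduct_mulVec]
  rw [smul_mulVec, dotProduct_smul, sub_mulVec, dotProduct_sub, hXH, smul_eq_mul] at h1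
  rw [hXu]
  set q := star u ⬝ᵥ X *ᵥ u
  have e1 : (I * (q - star q)).re = -2 * q.im := by
    simp; ring
  have e2 : (I * ω * q).re = -ω * q.im := by simp
  rw [e1] at h1
  rw [e2]
  nlinarith

-- Since `s (sI - A)⁻¹ = 1 + A (sI - A)⁻¹` tends to the identity, this is the limit of the frequency
-- inequality as `ω → ∞`.
open Filter Topology in
theorem re_infinity_nonneg {A : Matrix (Fin n) (Fin n) ℝ} {B : Matrix (Fin n) (Fin m) ℝ}
    {C : Matrix (Fin m) (Fin n) ℝ} (hA : IsHurwitz A) (u : Fin m → ℂ)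
    (h : ∀ ω : ℝ, 0 < ω → 0 ≤ (I * ω * (star u ⬝ᵥ C.map ofReal *ᵥ
      (((ω : ℂ) * I) • 1 - A.map ofReal)⁻¹ *ᵥ B.map ofReal *ᵥ u)).re) :
    0 ≤ (star u ⬝ᵥ C.map ofReal *ᵥ B.map ofReal *ᵥ u).re := by
  have hcont : Continuous fun R : Matrix (Fin n) (Fin n) ℂ =>
      (star u ⬝ᵥ C.map ofReal *ᵥ (1 + A.map ofReal * R) *ᵥ B.map ofReal *ᵥ u).re := by fun_prop
  have hlim := (hcont.tendsto 0).comp (tendsto_resolvent_imaginary_axis (A.map ofReal))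
  simp only [Matrix.mul_zero, add_zero, one_mulVec] at hlim
  refine ge_of_tendsto hlim ?_
  filter_upwards [eventually_gt_atTop 0] with ω hω
  have hinv := Matrix.mul_nonsing_inv (((ω : ℂ) * I) • 1 - A.map ofReal)
    (Ne.isUnit (hA.det_ne_zero (by simp)))
  rw [Matrix.sub_mul, Matrix.smul_mul, Matrix.one_mul, sub_eq_iff_eq_add] at hinv
  have := h ω hω
  rw [← smul_eq_mul, ← dotProduct_smul, ← mulVec_smul, ← smul_mulVec, mul_comm I, hinv] at this
  exact this

/-- Conjugation carries the inequality to negative frequencies because the system is real; at `ω =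
0` it is trivial. -/
theorem re_freq_nonneg_of_state_eq {A : Matrix (Fin n) (Fin n) ℝ} {B : Matrix (Fin n) (Fin m) ℝ}
    {C : Matrix (Fin m) (Fin n) ℝ} (hA : IsHurwitz A)
    (h : ∀ ω : ℝ, 0 < ω → ∀ u, 0 ≤ (I * ω * (star u ⬝ᵥ C.map ofReal *ᵥ
      (((ω : ℂ) * I) • 1 - A.map ofReal)⁻¹ *ᵥ B.map ofReal *ᵥ u)).re)
    (ω : ℝ) (x : Fin n → ℂ) (u : Fin m → ℂ)
    (hx : A.map ofReal *ᵥ x + B.map ofReal *ᵥ u = (I * ω) • x) :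
    0 ≤ (I * ω * (star u ⬝ᵥ C.map ofReal *ᵥ x)).re := by
  have hpos : ∀ ω : ℝ, 0 < ω → ∀ x u, A.map ofReal *ᵥ x + B.map ofReal *ᵥ u = (I * ω) • x →
      0 ≤ (I * ω * (star u ⬝ᵥ C.map ofReal *ᵥ x)).re := fun ω hω x u hx => by
    have hxu : x = (((ω : ℂ) * I) • 1 - A.map ofReal)⁻¹ *ᵥ B.map ofReal *ᵥ u := by
      have : B.map ofReal *ᵥ u = (((ω : ℂ) * I) • 1 - A.map ofReal) *ᵥ x := by
        rw [sub_mulVec, smul_mulVec, one_mulVec, mul_comm, ← hx, add_sub_cancel_left]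
      rw [this, mulVec_mulVec, Matrix.nonsing_inv_mul _ (Ne.isUnit (hA.det_ne_zero (by simp))),
        one_mulVec]
    rw [hxu]
    exact h ω hω u
  have hconj : ∀ {a b : ℕ} (M : Matrix (Fin a) (Fin b) ℝ) (v : Fin b → ℂ),
      star (M.map ofReal *ᵥ v) = M.map ofReal *ᵥ star v := by
    intro a b M v
    ext i; simp [mulVec, dotProduct]
  rcases lt_trichotomy ω 0 with hω | hω | hω
  · have h1 := hpos (-ω) (neg_pos.2 hω) (star x) (star u) (by
      rw [← hconj, ← hconj, ← star_add, hx, star_smul]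
      simp)
    rw [← Complex.conj_re]
    convert h1 using 2
    change star _ = _
    rw [← hconj, star_star, star_mul', ← star_dotProduct, dotProduct_comm u]
    simp
  · simp [hω]
  · exact hpos ω hω x u hx

end NegImag

/-! ### The equivalence -/

theorem corollary1 {n m : ℕ} (A : Matrix (Fin n) (Fin n) ℝ) (B : Matrix (Fin n) (Fin m) ℝ)
    (C : Matrix (Fin m) (Fin n) ℝ) (D : Matrix (Fin m) (Fin m) ℝ)
    (hmin : NegImag.IsMinimal A B C D) :
    NegImag.IsSNI (NegImag.transferMatrix A B C D) ↔
      (∀ ω : ℝ, ¬ Module.End.HasEigenvalue (Matrix.toLin' (A.map Complex.ofReal))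
          ((ω : ℂ) * Complex.I)) ∧
      D.IsSymm ∧
      (∃ Y : Matrix (Fin n) (Fin n) ℝ, Y.PosDef ∧
        (-(A * Y + Y * A.transpose)).PosSemidef ∧
        B + A * Y * C.transpose = 0) ∧
      (∀ ω : ℝ, ω ≠ 0 →
        ¬ NegImag.IsTransmissionZero
          (NegImag.transferMatrix A B C D -
            NegImag.reflectTranspose (NegImag.transferMatrix A B C D))
          ((ω : ℂ) * Complex.I)) := by
  open NegImag Matrix Complex in
  constructor
  · intro h
    have hA : IsHurwitz A := fun z v hv hz => h.poles z (hmin.isPole_of_eigenvalue hv hz)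
    have hpd : ∀ ω : ℝ, 0 < ω →
        (I • (transferValue A B C D (ω * I) - (transferValue A B C D (ω * I))ᴴ)).PosDef :=
      fun ω hω => by
        have := h.posDef ω hω
        rwa [hA.evalAt_transferMatrix] at this
    have hD := isSymm_of_posDef hpd
    have hfreq := fun ω hω => re_freq_nonneg hD hω (hpd ω hω)
    refine ⟨hA.not_hasEigenvalue, hD, ?_, fun ω hω => ?_⟩
    · exact exists_posDef_of_freq A B C hA (fun Q hQ => hmin.isControllable.eq_zero Q hQ)
        (fun x hx => hmin.transpose.isControllable.eq_zero_of_observable x hx)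
        (fun u => re_infinity_nonneg hA u fun ω hω => hfreq ω hω u)
        (re_freq_nonneg_of_state_eq hA hfreq)
    · have hinj : ∀ ω : ℝ, 0 < ω → ∀ v,
          (transferValue A B C D (ω * I) - (transferValue A B C D (ω * I))ᴴ) *ᵥ v = 0 → v = 0 :=
        fun ω hω v hv => by
          by_contra hv0
          have := (hpd ω hω).dotProduct_mulVec_pos hv0
          rw [smul_mulVec, hv, smul_zero, dotProduct_zero] at this
          exact lt_irrefl _ this
      rw [isTransmissionZero_iff (hasValue_sub_reflectTranspose A B C D hA ω)]
      rintro ⟨v, hv, hv0⟩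
      rcases lt_or_gt_of_ne hω with hneg | hpos
      -- Positive definiteness is known only for positive frequencies; a negative one is reached by
      -- transposition, which preserves singularity but not the kernel vector.
      · have hskew : transferValue A B C D (ω * I) - (transferValue A B C D (ω * I))ᴴ
            = -(transferValue A B C D ((-ω : ℝ) * I)
              - (transferValue A B C D ((-ω : ℝ) * I))ᴴ)ᵀ := by
          rw [conjTranspose_transferValue, conjTranspose_transferValue]
          simp
        have hdet := exists_mulVec_eq_zero_iff.1 ⟨v, hv, hv0⟩
        rw [hskew, det_neg, det_transpose, mul_eq_zero, or_iff_right (by simp)] at hdet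
        obtain ⟨v', hv', hv0'⟩ := exists_mulVec_eq_zero_iff.2 hdet
        exact hv' (hinj (-ω) (neg_pos.2 hneg) v' hv0')
      · exact hv (hinj ω hpos v hv0)
  · rintro ⟨h1, hD, ⟨Y, hY, hAY, hB⟩, h4⟩
    have hA := isHurwitz_of_lyapunov h1 hY hAY
    refine ⟨fun z hz => hA.re_neg_of_isPole hz, fun ω hω => ?_⟩
    rw [hA.evalAt_transferMatrix]
    have hpsd :
        (I • (transferValue A B C D (ω * I) - (transferValue A B C D (ω * I))ᴴ)).PosSemidef := by
      rw [imaginary_part_factorization hA hD hY.isHermitian hB]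
      exact ((posSemidef_map_ofReal hAY).mul_mul_conjTranspose_same _).smul
        (show (0 : ℂ) ≤ ω by exact_mod_cast hω.le)
    refine PosDef.of_dotProduct_mulVec_pos hpsd.isHermitian fun {v} hv => ?_
    refine (hpsd.dotProduct_mulVec_nonneg v).lt_of_ne' fun h0 => ?_
    rw [hpsd.dotProduct_mulVec_zero_iff, smul_mulVec, smul_eq_zero_iff_right I_ne_zero] at h0
    exact h4 ω hω.ne' ((isTransmissionZero_iff
      (hasValue_sub_reflectTranspose A B C D hA ω)).2 ⟨v, hv, h0⟩)
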